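/- For real $s>0$, a distribution $\mu$ on $\mathbb R^d$ is called $s$-subgaussian if, for every $k\in\mathbb N$ and every unit vector $u$, $\mathbb E_{x\sim\mu}\langle x-\mathbb E x,u\rangle^k$ exists and is at most $(s\sqrt k)^k$. For laws $\mathcal P,\mathcal Q$ on $(\mathbb R^d)^n$, the degree-$D$ advantage is $$\mathrm{Adv}_{\le D}(\mathcal P,\mathcal Q)=\sup_{f}\frac{\mathbb E_{\mathcal P}[f(y)]}{\sqrt{\mathbb E_{\mathcal Q}[f(y)^2]}},$$ where $f$ ranges over the nonzero real polynomials of degree at most $D$ in the $nd$ coordinates of $y$. **Proposition 8.16.** Let $i_*\ge 2$ be an even integer. There are real constants $c,c',C,s>0$ and $B$, and a real polynomial $p$ with $p(D)>0$ for all $D\in\mathbb N$, all depending only on $i_*$, such that the following holds. Let $d\ge 1$ be an integer and let $\eta,\alpha$ be real numbers with $$\frac{C}{\sqrt d}\le\eta\le 10^{-5},\qquad \eta\log(1/\eta)<\alpha<0.1,\qquad c'\,\eta^{1-\frac{2}{i_*+2}}\le\alpha\le c\,\eta^{1-\frac{2}{i_*}} .$$ Then there exist families $(D_v)$ and $(Q_v)$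 of probability distributions on $\mathbb R^d$, depending measurably on $v$ in the unit sphere $\mathcal S^{d-1}$, such that every $D_v$ is centered, $s$-subgaussian and has a covariance matrix $\Sigma_v$ with $\|\Sigma_v-I_d\|_{\mathrm{op}}\ge\alpha$, and such that for all $n,D\in\mathbb N$ with $$C\,d\le n\le\frac{d^{\frac{i_*+2}{2}}\,\eta^{i_*}}{p(D)\,\alpha^{i_*+2}}$$ the problem of testing * $H_0$: $y_1,\dots,y_n$ are i.i.d. from $\mathcal N(0,I_d)$, against * $H_1$: $v$ is drawn uniformly from $\mathcal S^{d-1}$ and then, conditionally on $v$, $y_1,\dots,y_n$ are i.i.d. from $(1-\eta)D_v+\eta Q_v$, has degree-$D$ advantage $\mathrm{Adv}_{\le D}(H_1,H_0)\le B$, where all polynomials of degree at most $D$ are integrable under $H_1$. -/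

import Mathlib

open MeasureTheory ProbabilityTheory
open scoped ENNReal RealInnerProductSpace

namespace LowDegree

/-- The space `ℝ^d` with its Euclidean norm. -/
abbrev Space (d : ℕ) : Type := EuclideanSpace ℝ (Fin d)

/-- The unit sphere of `ℝ^d`. -/
abbrev UnitSphere (d : ℕ) : Type := Metric.sphere (0 : Space d) 1

/-- The uniform (rotation invariant) probability measure on the unit sphere of `ℝ^d`, `d ≥ 1`:
the surface measure divided by its total mass. -/
noncomputable def uniformSphere (d : ℕ) : Measure (UnitSphere d) :=
  ((volume : Measure (Space d)).toSphere Set.univ)⁻¹ • (volume : Measure (Space d)).toSphere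

/-- For `d ≥ 1` the measure `uniformSphere d` is a probability measure. -/
theorem isProbabilityMeasure_uniformSphere {d : ℕ} (hd : 0 < d) :
    IsProbabilityMeasure (uniformSphere d) := by
  have : Nonempty (Fin d) := ⟨⟨0, hd⟩⟩
  constructor
  have h0 : (volume : Measure (Space d)).toSphere Set.univ ≠ 0 := by
    rw [Ne, Measure.measure_univ_eq_zero]
    exact Measure.toSphere_ne_zero _
  rw [uniformSphere, Measure.smul_apply, smul_eq_mul]
  exact ENNReal.inv_mul_cancel h0 (measure_ne_top _ _)

/-- A distribution `μ` on `ℝ^d` is `s`-subgaussian: for every `k` and every unit vector `u`, the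
moment `E ⟨x - E x, u⟩ ^ k` exists and is at most `(s √k) ^ k`. -/
def IsSubgaussian {d : ℕ} (s : ℝ) (μ : Measure (Space d)) : Prop :=
  ∀ (k : ℕ) (u : Space d), ‖u‖ = 1 →
    Integrable (fun x : Space d => ⟪x - ∫ z, z ∂μ, u⟫ ^ k) μ ∧
      ∫ x, ⟪x - ∫ z, z ∂μ, u⟫ ^ k ∂μ ≤ (s * √(k : ℝ)) ^ k

/-- The covariance matrix `Σ i j = Cov (x i, x j)` of a distribution on `ℝ^d`. -/
noncomputable def covMatrix {d : ℕ} (μ : Measure (Space d)) : Matrix (Fin d) (Fin d) ℝ :=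
  Matrix.of fun i j => cov[fun x : Space d => x i, fun x : Space d => x j; μ]

/-- Admissible inlier distributions: centered, `s`-subgaussian, and with a covariance matrix `Σ`
such that `‖Σ - I‖ ≥ α` in operator norm (the norm as an operator on the Euclidean space). -/
structure IsInlier {d : ℕ} (s α : ℝ) (μ : Measure (Space d)) : Prop where
  isProbabilityMeasure : IsProbabilityMeasure μ
  mean_eq_zero : ∫ x, x ∂μ = 0
  isSubgaussian : IsSubgaussian s μ
  le_norm_cov_sub : α ≤ ‖Matrix.toEuclideanCLM (n := Fin d) (𝕜 := ℝ) (covMatrix μ - 1)‖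

/-- The null hypothesis: `y₁, …, yₙ` i.i.d. from `N(0, I_d)`. -/
noncomputable def nullLaw (d n : ℕ) : Measure (Fin n → Space d) :=
  Measure.pi fun _ => stdGaussian (Space d)

/-- The contaminated distribution `(1 - η) D + η Q`. -/
noncomputable def contaminated {d : ℕ} (η : ℝ) (D Q : Measure (Space d)) : Measure (Space d) :=
  ENNReal.ofReal (1 - η) • D + ENNReal.ofReal η • Q

/-- The alternative hypothesis: `v` is uniform on the unit sphere and, conditionally on `v`,
`y₁, …, yₙ` are i.i.d. from `(1 - η) D_v + η Q_v`. The families `D` and `Q` are Markov kernels,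
that is, probability measures depending measurably on `v`. -/
noncomputable def altLaw (d n : ℕ) (η : ℝ) (D Q : Kernel (UnitSphere d) (Space d)) :
    Measure (Fin n → Space d) :=
  (uniformSphere d).bind fun v => Measure.pi fun _ => contaminated η (D v) (Q v)

/-- The law of the sample depends measurably on `v`, so the mixture in `altLaw` is meaningful. -/
theorem measurable_pi_contaminated (d n : ℕ) (η : ℝ) (D Q : Kernel (UnitSphere d) (Space d))
    [IsMarkovKernel D] [IsMarkovKernel Q] :
    Measurable fun v => Measure.pi fun _ : Fin n => contaminated η (D v) (Q v) := by
  have hfin : ∀ v, IsFiniteMeasure (contaminated η (D v) (Q v)) := fun v => by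
    constructor
    simp [contaminated, ENNReal.ofReal_lt_top]
  refine Measurable.measure_of_isPiSystem generateFrom_pi.symm isPiSystem_pi ?_ ?_
  · rintro _ ⟨t, ht, rfl⟩
    simp only [Measure.pi_pi]
    refine Finset.measurable_prod _ fun i _ => ?_
    have hti : MeasurableSet (t i) := ht i (Set.mem_univ i)
    simp only [contaminated, Measure.add_apply, Measure.smul_apply, smul_eq_mul]
    exact ((D.measurable_coe hti).const_mul _).add ((Q.measurable_coe hti).const_mul _)
  · simp only [Measure.pi_univ]
    simp [contaminated]

/-- The value at the sample `y = (y₁, …, yₙ)` of a polynomial in the `n d` coordinates of `y`. -/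
noncomputable def evalSample {d n : ℕ} (f : MvPolynomial (Fin n × Fin d) ℝ)
    (y : Fin n → Space d) : ℝ :=
  MvPolynomial.eval (fun ij : Fin n × Fin d => y ij.1 ij.2) f

/-- The degree-`D` advantage for testing the law `Q` (null) against the law `P` (alternative): the
supremum of `E_P f / √(E_Q f²)` over the nonzero polynomials `f` of degree at most `D`. It is an
extended real number, so that an unbounded family of ratios gives `⊤`. -/
noncomputable def advantage {d n : ℕ} (D : ℕ) (P Q : Measure (Fin n → Space d)) : EReal :=
  ⨆ f : {f : MvPolynomial (Fin n × Fin d) ℝ // f ≠ 0 ∧ f.totalDegree ≤ D},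
    (((∫ y, evalSample f.1 y ∂P) / √(∫ y, (evalSample f.1 y) ^ 2 ∂Q) : ℝ) : EReal)

end LowDegree

/-!
Let `i` be the even integer of the statement and put `t² = 1 + α / η`. Along a hidden direction `v`
the outliers are the two points `± t` with equal weights, and the inliers are the standard Gaussian
with a density `1 + q`; orthogonally to `v` everything is standard Gaussian. The function `q` is
supported on `[-1, 1]` and chosen so that the mixture has the Gaussian moments up to order `i + 1`.
Such a `q` exists because the corresponding Gram matrix is invertible (`exists_bounded_dual`), and
`|q| ≤ 1 / 2` because `η t ^ i` is small, which is what `α ≤ c η ^ (1 - 2 / i)` says. Hence the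
inliers have density at most `2` with respect to the Gaussian, so they are subgaussian, and matching
second moments forces their variance along `v` to be `1 - α / (1 - η)`.

If `a k` is the Hermite coefficient `E[h_k]` of the mixture along `v`, then `a k = 0` for
`1 ≤ k ≤ i + 1`, and `a k ^ 2 ≤ (K + 1) ^ 2 η ^ 2 k! t ^ (2 k)` for larger `k`
(`exists_moment_matching`). A polynomial of degree at most `D` in the sample cannot distinguish the
i.i.d. law from the Hermite expansion of its likelihood ratio truncated at total degree `D`
(`integral_pi_hiddenLaw_eq`). By Cauchy–Schwarz the squared advantage is at most the second moment
of the average over `v` of these truncations, that is, a double average over two independent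
directions `v`, `w`. Since `E[h_k(⟪y, v⟫) h_l(⟪y, w⟫)]` is `⟪v, w⟫ ^ k` if `k = l` and zero
otherwise, and since `E ⟪v, w⟫ ^ m ≤ (D / d) ^ (m / 2)` for `m ≤ D`, the squared advantage is at most
`(∑ k ≤ D, a k ^ 2 (D / d) ^ (k / 2)) ^ n` (`advantage_hiddenKernel_le`).

The sum is `1` plus a tail dominated by a geometric series whose first term is of order
`η ^ 2 (α ^ 2 D ^ 3 / (η ^ 2 d)) ^ ((i + 2) / 2)`. With `p(D)` a large multiple of
`(D + 1) ^ (3 (i + 2) / 2)`, the upper bound on `n` makes `n` times this term at most `1`; together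
with `n ≥ d` and `η ^ 2 d ≥ 1` it also makes the ratio of the series at most `1 / 2`
(`sum_hermite_pow_le_four`). The factor `k! ≤ D ^ k` is absorbed by `p(D)`.
-/

namespace LowDegree

/-! ### Hermite polynomials and the Gaussian measure on the line -/

/-- The normalized probabilists' Hermite polynomial `He_k / √k!`, with real coefficients. -/
noncomputable def hermiteNorm (k : ℕ) : Polynomial ℝ :=
  Polynomial.C (√(k.factorial : ℝ))⁻¹ * (Polynomial.hermite k).map (Int.castRingHom ℝ)

/-- All moments of the measure `μ` on the line are finite. -/
def HasMoments (μ : Measure ℝ) : Prop := ∀ k : ℕ, Integrable (fun x : ℝ => x ^ k) μ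

theorem HasMoments.integrable_eval {μ : Measure ℝ} (hμ : HasMoments μ) (P : Polynomial ℝ) :
    Integrable (fun x => P.eval x) μ := by
  simp only [Polynomial.eval_eq_sum_range]
  exact integrable_finsetSum _ fun k _ => (hμ k).const_mul _

theorem hasMoments_gaussianReal : HasMoments (gaussianReal 0 1) := by
  intro k
  have h := (memLp_id_gaussianReal' (μ := 0) (v := 1) (k : ℝ≥0∞) (by simp)).integrable_norm_pow'
  refine h.mono' (by fun_prop) (Filter.Eventually.of_forall fun x => ?_)
  simp

/-- Gaussian integration by parts for polynomials. -/
theorem integral_X_mul_gaussianReal (P : Polynomial ℝ) :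
    ∫ x, x * P.eval x ∂(gaussianReal 0 1) = ∫ x, P.derivative.eval x ∂(gaussianReal 0 1) := by
  have hint : ∀ R : Polynomial ℝ, Integrable (fun x => gaussianPDFReal 0 1 x * R.eval x) := by
    intro R
    have h := hasMoments_gaussianReal.integrable_eval R
    rw [gaussianReal_of_var_ne_zero _ one_ne_zero,
      integrable_withDensity_iff_integrable_smul₀' (by fun_prop)
        (Filter.Eventually.of_forall fun x => gaussianPDF_lt_top)] at h
    simpa [toReal_gaussianPDF] using h
  have hderiv : ∀ x : ℝ, HasDerivAt (fun x => gaussianPDFReal 0 1 x * P.eval x)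
      (gaussianPDFReal 0 1 x * (P.derivative - Polynomial.X * P).eval x) x := by
    intro x
    have h1 : HasDerivAt (gaussianPDFReal 0 1) (gaussianPDFReal 0 1 x * (-x)) x := by
      have h2 : HasDerivAt (fun x : ℝ => -(x - 0) ^ 2 / (2 * ((1 : NNReal) : ℝ))) (-x) x := by
        have h3 : HasDerivAt (fun x : ℝ => -(x - 0) ^ 2) (-(2 * x)) x := by
          
          have h4 := ((hasDerivAt_id x).pow 2).neg
          simp only [Nat.cast_ofNat, id_eq, Nat.add_one_sub_one, pow_one, mul_one] at h4
          simp only [sub_zero]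
          exact h4
        refine (h3.div_const (2 * ((1 : NNReal) : ℝ))).congr_deriv ?_
        simp
        ring
      refine (h2.exp.const_mul (√(2 * Real.pi * ((1 : NNReal) : ℝ)))⁻¹).congr_deriv ?_
      simp only [gaussianPDFReal]
      ring
    refine (h1.mul (P.hasDerivAt x)).congr_deriv ?_
    simp
    ring
  have h0 := integral_eq_zero_of_hasDerivAt_of_integrable hderiv (hint _) (hint _)
  rw [← sub_eq_zero, ← integral_sub]
  · rw [← neg_eq_zero, ← integral_neg, integral_gaussianReal_eq_integral_smul one_ne_zero]
    refine Eq.trans (integral_congr_ae (Filter.Eventually.of_forall fun x => ?_)) h0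
    simp only [smul_eq_mul, Polynomial.eval_sub, Polynomial.eval_mul, Polynomial.eval_X]
    ring
  · have := hasMoments_gaussianReal.integrable_eval (Polynomial.X * P)
    simpa using this
  · exact hasMoments_gaussianReal.integrable_eval _

theorem integral_even_pow_gaussianReal_le (m : ℕ) :
    ∫ x, x ^ (2 * m) ∂(gaussianReal 0 1) ≤ (2 * m : ℝ) ^ m := by
  induction m with
  | zero => simp
  | succ m ih =>
    have h := integral_X_mul_gaussianReal (Polynomial.X ^ (2 * m + 1))
    have e1 : ∀ x : ℝ, x * (Polynomial.X ^ (2 * m + 1) : Polynomial ℝ).eval x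
        = x ^ (2 * (m + 1)) := fun x => by simp; ring
    have e2 : ∀ x : ℝ, (Polynomial.X ^ (2 * m + 1) : Polynomial ℝ).derivative.eval x
        = (2 * m + 1) * x ^ (2 * m) := fun x => by simp
    simp only [e1, e2] at h
    rw [h, integral_const_mul, pow_succ]
    push_cast
    have h1 : (2 * m : ℝ) ^ m ≤ (2 * (m + 1) : ℝ) ^ m := by gcongr; linarith
    have h2 : (0 : ℝ) ≤ (2 * (m + 1) : ℝ) ^ m := by positivity
    have : (0 : ℝ) ≤ m := by positivity
    calc (2 * (m : ℝ) + 1) * ∫ x, x ^ (2 * m) ∂(gaussianReal 0 1)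
        ≤ (2 * m + 1) * (2 * (m + 1) : ℝ) ^ m := by gcongr; linarith
      _ ≤ (2 * (m + 1) : ℝ) ^ m * (2 * (m + 1)) := by nlinarith

/-- Pairing with the `k`-th Hermite polynomial under the standard Gaussian amounts to averaging the
`k`-th derivative. -/
theorem integral_hermite_mul (k : ℕ) (P : Polynomial ℝ) :
    ∫ x, ((Polynomial.hermite k).map (Int.castRingHom ℝ)).eval x * P.eval x ∂(gaussianReal 0 1)
      = ∫ x, (Polynomial.derivative^[k] P).eval x ∂(gaussianReal 0 1) := by
  induction k generalizing P with
  | zero => simp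
  | succ k ih =>
    rw [Function.iterate_succ_apply, ← ih]
    set H := (Polynomial.hermite k).map (Int.castRingHom ℝ)
    have e : (Polynomial.hermite (k + 1)).map (Int.castRingHom ℝ)
        = Polynomial.X * H - Polynomial.derivative H := by
      simp [H, Polynomial.hermite_succ, Polynomial.derivative_map]
    have hs := integral_X_mul_gaussianReal (H * P)
    have i1 := hasMoments_gaussianReal.integrable_eval (Polynomial.X * (H * P))
    have i2 := hasMoments_gaussianReal.integrable_eval (Polynomial.derivative H * P)
    have i3 := hasMoments_gaussianReal.integrable_eval (H * Polynomial.derivative P)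
    simp only [Polynomial.eval_mul, Polynomial.eval_X, Polynomial.derivative_mul,
      Polynomial.eval_add] at hs i1 i2 i3
    rw [integral_add i2 i3] at hs
    rw [e]
    have : ∀ x : ℝ, (Polynomial.X * H - Polynomial.derivative H).eval x * P.eval x
        = x * (H.eval x * P.eval x) - (Polynomial.derivative H).eval x * P.eval x :=
      fun x => by simp; ring
    simp only [this]
    rw [integral_sub i1 i2, hs]
    ring

/-- The `k`-th Hermite polynomial reads off the coefficient of degree `k` of polynomials of degree
at most `k`; for lower degrees the pairing vanishes. -/
theorem integral_hermiteNorm_mul {k : ℕ} {P : Polynomial ℝ} (hP : P.natDegree ≤ k) :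
    ∫ x, (hermiteNorm k).eval x * P.eval x ∂(gaussianReal 0 1)
      = √(k.factorial : ℝ) * P.coeff k := by
  have h := integral_hermite_mul k P
  have h1 : Polynomial.derivative^[k] P = Polynomial.C ((k.factorial : ℝ) * P.coeff k) := by
    ext m
    rw [Polynomial.coeff_iterate_derivative, Polynomial.coeff_C]
    rcases m with _ | m
    · simp [Nat.descFactorial_self]
    · rw [Polynomial.coeff_eq_zero_of_natDegree_lt (by omega)]
      simp
  rw [h1] at h
  simp only [hermiteNorm, Polynomial.eval_mul, Polynomial.eval_C, mul_assoc]
  rw [integral_const_mul, h]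
  simp only [Polynomial.eval_C, integral_const, probReal_univ, one_smul]
  have : (0 : ℝ) < k.factorial := by positivity
  have h2 := Real.mul_self_sqrt this.le
  have h3 : √(k.factorial : ℝ) ≠ 0 := by positivity
  field_simp
  rw [pow_two, h2]

theorem natDegree_hermiteNorm_le (k : ℕ) : (hermiteNorm k).natDegree ≤ k := by
  unfold hermiteNorm
  refine (Polynomial.natDegree_C_mul_le _ _).trans ?_
  exact Polynomial.natDegree_map_le.trans Polynomial.natDegree_hermite.le

theorem coeff_hermiteNorm_self (k : ℕ) :
    (hermiteNorm k).coeff k = (√(k.factorial : ℝ))⁻¹ := by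
  simp [hermiteNorm, Polynomial.coeff_hermite_self]

theorem natDegree_hermiteNorm (k : ℕ) : (hermiteNorm k).natDegree = k := by
  refine le_antisymm (natDegree_hermiteNorm_le k) (Polynomial.le_natDegree_of_ne_zero ?_)
  rw [coeff_hermiteNorm_self]
  positivity

@[simp] theorem hermiteNorm_zero : hermiteNorm 0 = 1 := by simp [hermiteNorm]

theorem integral_hermiteNorm_mul_of_lt {k : ℕ} {P : Polynomial ℝ} (hP : P.natDegree < k) :
    ∫ x, (hermiteNorm k).eval x * P.eval x ∂(gaussianReal 0 1) = 0 := by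
  rw [integral_hermiteNorm_mul hP.le, Polynomial.coeff_eq_zero_of_natDegree_lt hP, mul_zero]

theorem integral_hermiteNorm_mul_self (k : ℕ) :
    ∫ x, (hermiteNorm k).eval x * (hermiteNorm k).eval x ∂(gaussianReal 0 1) = 1 := by
  rw [integral_hermiteNorm_mul (natDegree_hermiteNorm_le k), coeff_hermiteNorm_self]
  have : √(k.factorial : ℝ) ≠ 0 := by positivity
  field_simp

theorem integral_hermiteNorm_mul_hermiteNorm (k l : ℕ) :
    ∫ x, (hermiteNorm k).eval x * (hermiteNorm l).eval x ∂(gaussianReal 0 1)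
      = if k = l then 1 else 0 := by
  rcases lt_trichotomy k l with h | h | h
  · rw [if_neg h.ne]
    simp only [mul_comm ((hermiteNorm k).eval _)]
    exact integral_hermiteNorm_mul_of_lt (by rwa [natDegree_hermiteNorm])
  · subst h
    simpa using integral_hermiteNorm_mul_self k
  · rw [if_neg h.ne']
    exact integral_hermiteNorm_mul_of_lt (by rwa [natDegree_hermiteNorm])

theorem eq_sum_hermiteNorm (P : Polynomial ℝ) {K : ℕ} (hP : P.natDegree ≤ K) :
    ∃ c : ℕ → ℝ, P = ∑ k ∈ Finset.range (K + 1), Polynomial.C (c k) * hermiteNorm k := by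
  induction K generalizing P with
  | zero =>
    refine ⟨fun _ => P.coeff 0, ?_⟩
    simpa using Polynomial.eq_C_of_natDegree_le_zero hP
  | succ K ih =>
    set a : ℝ := P.coeff (K + 1) * √((K + 1).factorial : ℝ)
    have hdeg : (P - Polynomial.C a * hermiteNorm (K + 1)).natDegree ≤ K := by
      rw [Polynomial.natDegree_le_iff_coeff_eq_zero]
      intro m hm
      rcases Nat.lt_or_ge (K + 1) m with h | h
      · simp only [Polynomial.coeff_sub, Polynomial.coeff_C_mul]
        rw [Polynomial.coeff_eq_zero_of_natDegree_lt (hP.trans_lt h),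
          Polynomial.coeff_eq_zero_of_natDegree_lt ((natDegree_hermiteNorm_le _).trans_lt h)]
        simp
      · obtain rfl : m = K + 1 := by omega
        have : √((K + 1).factorial : ℝ) ≠ 0 := by positivity
        simp only [Polynomial.coeff_sub, Polynomial.coeff_C_mul, coeff_hermiteNorm_self, a]
        field_simp
        simp
    obtain ⟨c, hc⟩ := ih _ hdeg
    refine ⟨fun k => if k = K + 1 then a else c k, ?_⟩
    rw [Finset.sum_range_succ]
    simp only [if_true]
    rw [← sub_eq_iff_eq_add, hc]
    refine Finset.sum_congr rfl fun k hk => ?_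
    rw [if_neg (by simp at hk; omega)]

/-- Expectations of polynomials of degree at most `K` under `μ` are computed under the standard
Gaussian with the density `∑ k ≤ K, E_μ[h_k] h_k`. -/
theorem integral_eval_eq_sum {μ : Measure ℝ} (hμ : HasMoments μ) (P : Polynomial ℝ) {K : ℕ}
    (hP : P.natDegree ≤ K) :
    ∫ x, P.eval x ∂μ = ∑ k ∈ Finset.range (K + 1), (∫ x, (hermiteNorm k).eval x ∂μ) *
      ∫ x, (hermiteNorm k).eval x * P.eval x ∂(gaussianReal 0 1) := by
  obtain ⟨c, hc⟩ := eq_sum_hermiteNorm P hP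
  have h1 : ∀ k ∈ Finset.range (K + 1),
      ∫ x, (hermiteNorm k).eval x * P.eval x ∂(gaussianReal 0 1) = c k := by
    intro k hk
    have e : ∀ x, (hermiteNorm k).eval x * P.eval x = ∑ l ∈ Finset.range (K + 1),
        c l * ((hermiteNorm k).eval x * (hermiteNorm l).eval x) := by
      intro x
      rw [hc, Polynomial.eval_finsetSum, Finset.mul_sum]
      refine Finset.sum_congr rfl fun l _ => ?_
      simp
      ring
    simp only [e]
    rw [integral_finsetSum]
    · simp only [integral_const_mul, integral_hermiteNorm_mul_hermiteNorm]
      simp [Finset.mem_range.1 hk]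
    · intro l _
      have := hasMoments_gaussianReal.integrable_eval (hermiteNorm k * hermiteNorm l)
      simp only [Polynomial.eval_mul] at this
      exact this.const_mul _
  rw [Finset.sum_congr rfl fun k hk => by rw [h1 k hk]]
  have e : ∀ x, P.eval x = ∑ k ∈ Finset.range (K + 1), c k * (hermiteNorm k).eval x := by
    intro x
    conv_lhs => rw [hc]
    simp [Polynomial.eval_finsetSum]
  simp only [e]
  rw [integral_finsetSum _ fun k _ => (hμ.integrable_eval _).const_mul _]
  simp only [integral_const_mul, mul_comm]

theorem derivative_hermite_succ (k : ℕ) :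
    Polynomial.derivative (Polynomial.hermite (k + 1))
      = Polynomial.C ((k : ℤ) + 1) * Polynomial.hermite k := by
  induction k with
  | zero => simp
  | succ k ih =>
    rw [Polynomial.hermite_succ (k + 1), Polynomial.derivative_sub, Polynomial.derivative_mul, ih,
      Polynomial.derivative_mul, Polynomial.derivative_X, Polynomial.derivative_C,
      Polynomial.hermite_succ k]
    push_cast
    simp only [Polynomial.C_add, Polynomial.C_1]
    ring

/-- A crude bound, from the recursion `He_{k+2} = x He_{k+1} - (k+1) He_k`. -/
theorem abs_eval_hermite_le (k : ℕ) {t : ℝ} (ht : 1 ≤ |t|) :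
    |((Polynomial.hermite k).map (Int.castRingHom ℝ)).eval t| ≤ k.factorial * |t| ^ k := by
  induction k using Nat.strong_induction_on with
  | _ k ih =>
    rcases k with _ | _ | k
    · simp
    · simp
    · have h1 := ih (k + 1) (by omega)
      have h0 := ih k (by omega)
      have e : ((Polynomial.hermite (k + 2)).map (Int.castRingHom ℝ)).eval t
          = t * ((Polynomial.hermite (k + 1)).map (Int.castRingHom ℝ)).eval t
            - (k + 1) * ((Polynomial.hermite k).map (Int.castRingHom ℝ)).eval t := by
        rw [Polynomial.hermite_succ (k + 1), derivative_hermite_succ]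
        simp
      rw [e]
      refine (abs_sub _ _).trans ?_
      rw [abs_mul, abs_mul]
      have hk : |(k : ℝ) + 1| = k + 1 := abs_of_pos (by positivity)
      rw [hk]
      have hp : |t| ^ k ≤ |t| ^ (k + 2) := pow_le_pow_right₀ ht (by omega)
      have hf : (((k + 2).factorial : ℕ) : ℝ) = (k + 2) * ((k + 1) * k.factorial) := by
        rw [Nat.factorial_succ, Nat.factorial_succ]; push_cast; ring
      have hf1 : (((k + 1).factorial : ℕ) : ℝ) = (k + 1) * k.factorial := by
        rw [Nat.factorial_succ]; push_cast; ring
      rw [hf1] at h1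
      rw [hf]
      have hk0 : (0 : ℝ) ≤ k := by positivity
      have hk1 : (0 : ℝ) ≤ (k.factorial : ℝ) := by positivity
      calc |t| * |_| + (k + 1) * |_|
          ≤ |t| * ((k + 1) * k.factorial * |t| ^ (k + 1)) + (k + 1) * (k.factorial * |t| ^ (k + 2))
            := by gcongr; exact h0.trans (by gcongr)
        _ = 2 * ((k + 1) * k.factorial * |t| ^ (k + 2)) := by ring
        _ ≤ (k + 2) * ((k + 1) * k.factorial * |t| ^ (k + 2)) := by gcongr; linarith
        _ = _ := by ring

theorem sq_eval_hermiteNorm_le (k : ℕ) {t : ℝ} (ht : 1 ≤ |t|) :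
    ((hermiteNorm k).eval t) ^ 2 ≤ k.factorial * (t ^ 2) ^ k := by
  have h := abs_eval_hermite_le k ht
  have hk : (0 : ℝ) < (k.factorial : ℝ) := by positivity
  rw [hermiteNorm, Polynomial.eval_mul, Polynomial.eval_C, mul_pow, inv_pow, Real.sq_sqrt hk.le,
    ← sq_abs (Polynomial.eval t _)]
  calc (k.factorial : ℝ)⁻¹ * |_| ^ 2 ≤ (k.factorial : ℝ)⁻¹ * (k.factorial * |t| ^ k) ^ 2 := by
        gcongr
    _ = k.factorial * (|t| ^ 2) ^ k := by
        rw [mul_pow, ← pow_mul, mul_comm k 2, pow_mul]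
        field_simp
    _ = _ := by rw [sq_abs]

/-! ### Laws with a hidden direction -/

/-- The point obtained from `z` by replacing its component along the unit vector `v` by `t`, where
`p = (z, t)`. -/
noncomputable def replaceCoord {d : ℕ} (v : Space d) (p : Space d × ℝ) : Space d :=
  p.1 + (p.2 - ⟪p.1, v⟫) • v

theorem continuous_replaceCoord {d : ℕ} :
    Continuous fun q : Space d × Space d × ℝ => replaceCoord q.1 q.2 := by
  unfold replaceCoord
  fun_prop

@[fun_prop]
theorem measurable_replaceCoord {d : ℕ} (v : Space d) : Measurable (replaceCoord v) := by
  unfold replaceCoord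
  fun_prop

@[simp]
theorem inner_replaceCoord_self {d : ℕ} {v : Space d} (hv : ‖v‖ = 1) (p : Space d × ℝ) :
    ⟪replaceCoord v p, v⟫ = p.2 := by
  rw [replaceCoord, inner_add_left, real_inner_smul_left, real_inner_self_eq_norm_sq, hv]
  ring

theorem norm_replaceCoord_le {d : ℕ} {v : Space d} (hv : ‖v‖ = 1) (p : Space d × ℝ) :
    ‖replaceCoord v p‖ ≤ 2 * ‖p.1‖ + |p.2| := by
  have h1 : |⟪p.1, v⟫| ≤ ‖p.1‖ := by simpa [hv] using abs_real_inner_le_norm p.1 v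
  calc ‖replaceCoord v p‖ ≤ ‖p.1‖ + ‖(p.2 - ⟪p.1, v⟫) • v‖ := norm_add_le _ _
    _ = ‖p.1‖ + |p.2 - ⟪p.1, v⟫| := by rw [norm_smul, hv, mul_one, Real.norm_eq_abs]
    _ ≤ ‖p.1‖ + (|p.2| + |⟪p.1, v⟫|) := by gcongr; exact abs_sub _ _
    _ ≤ _ := by linarith

/-- The law on `ℝ^d` with hidden direction `v`: the component along `v` has law `ν`, the orthogonal
component is standard Gaussian and independent of it. -/
noncomputable def hiddenLaw {d : ℕ} (ν : Measure ℝ) (v : Space d) : Measure (Space d) :=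
  ((stdGaussian (Space d)).prod ν).map (replaceCoord v)

/-- Resampling the component of a standard Gaussian along `v` does not change its law. -/
theorem hiddenLaw_gaussianReal {d : ℕ} {v : Space d} (hv : ‖v‖ = 1) :
    hiddenLaw (gaussianReal 0 1) v = stdGaussian (Space d) := by
  have : IsProbabilityMeasure (hiddenLaw (gaussianReal 0 1) v) :=
    Measure.isProbabilityMeasure_map (by fun_prop)
  refine Measure.ext_of_charFun (funext fun u => ?_)
  have e : ∀ p : Space d × ℝ, Complex.exp (⟪replaceCoord v p, u⟫ * Complex.I)
      = Complex.exp (⟪p.1, u - ⟪v, u⟫ • v⟫ * Complex.I)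
        * Complex.exp (⟪v, u⟫ * p.2 * Complex.I) := by
    intro p
    rw [← Complex.exp_add, replaceCoord, inner_add_left, real_inner_smul_left, inner_sub_right,
      real_inner_smul_right]
    push_cast
    ring_nf
  have hn : ‖u - ⟪v, u⟫ • v‖ ^ 2 = ‖u‖ ^ 2 - ⟪v, u⟫ ^ 2 := by
    rw [norm_sub_sq_real, real_inner_smul_right, norm_smul, hv, Real.norm_eq_abs, mul_one, sq_abs,
      real_inner_comm]
    ring
  rw [hiddenLaw, charFun_apply, integral_map (by fun_prop)
    (Measurable.aestronglyMeasurable (by fun_prop))]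
  simp only [e]
  rw [integral_prod_mul (fun z : Space d => Complex.exp (⟪z, u - ⟪v, u⟫ • v⟫ * Complex.I))
      (fun s : ℝ => Complex.exp (⟪v, u⟫ * s * Complex.I)), ← charFun_apply, ← charFun_apply_real,
    charFun_stdGaussian, charFun_stdGaussian, charFun_gaussianReal, ← Complex.exp_add]
  congr 1
  norm_cast
  rw [hn]
  push_cast
  ring

theorem integral_hiddenLaw {d : ℕ} (ν : Measure ℝ) (v : Space d)
    {F : Space d → ℝ} (hF : Measurable F) :
    ∫ y, F y ∂(hiddenLaw ν v) = ∫ p, F (replaceCoord v p) ∂((stdGaussian (Space d)).prod ν) := by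
  rw [hiddenLaw, integral_map (by fun_prop) hF.aestronglyMeasurable]

theorem map_inner_hiddenLaw {d : ℕ} (ν : Measure ℝ) [SFinite ν] {v : Space d} (hv : ‖v‖ = 1) :
    (hiddenLaw ν v).map (fun y => ⟪y, v⟫) = ν := by
  rw [hiddenLaw, Measure.map_map (by fun_prop) (by fun_prop)]
  have : (fun y => ⟪y, v⟫) ∘ replaceCoord v = Prod.snd :=
    funext fun p => inner_replaceCoord_self hv p
  rw [this, Measure.map_snd_prod]
  simp

theorem map_inner_stdGaussian {d : ℕ} {v : Space d} (hv : ‖v‖ = 1) :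
    (stdGaussian (Space d)).map (fun y => ⟪y, v⟫) = gaussianReal 0 1 := by
  conv_lhs => rw [← hiddenLaw_gaussianReal hv]
  exact map_inner_hiddenLaw _ hv

/-! ### Moments of the uniform distribution on the sphere -/

/-- The action of a linear isometry on the unit sphere. -/
noncomputable def sphereMap {d : ℕ} (g : Space d ≃ₗᵢ[ℝ] Space d) (v : UnitSphere d) :
    UnitSphere d :=
  ⟨g v, by simp⟩

theorem measurable_sphereMap {d : ℕ} (g : Space d ≃ₗᵢ[ℝ] Space d) : Measurable (sphereMap g) :=
  Measurable.subtype_mk (by fun_prop)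

open scoped Pointwise in
theorem map_sphereMap_uniformSphere {d : ℕ} (g : Space d ≃ₗᵢ[ℝ] Space d) :
    (uniformSphere d).map (sphereMap g) = uniformSphere d := by
  ext s hs
  rw [Measure.map_apply (measurable_sphereMap g) hs, uniformSphere, Measure.smul_apply,
    Measure.smul_apply]
  congr 1
  rw [Measure.toSphere_apply' _ hs, Measure.toSphere_apply' _ (measurable_sphereMap g hs)]
  congr 1
  have h := g.measurePreserving.measure_preimage_emb g.toHomeomorph.measurableEmbedding
    (Set.Ioo (0 : ℝ) 1 • ((↑) '' s : Set (Space d)))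
  rw [← h]
  congr 1
  ext x
  simp only [Set.mem_smul, Set.mem_image, Set.mem_preimage, Subtype.exists, exists_and_right,
    exists_eq_right]
  constructor
  · rintro ⟨r, hr, y, ⟨hy, hys⟩, rfl⟩
    exact ⟨r, hr, g y, ⟨by simpa using hy, hys⟩, by simp⟩
  · rintro ⟨r, hr, y, ⟨hy, hys⟩, hxy⟩
    refine ⟨r, hr, g.symm y, ⟨by simpa using hy, ?_⟩, ?_⟩
    · simpa [sphereMap] using hys
    · rw [← map_smul, hxy]
      simp

/-- By rotation invariance, the moments of `⟪v, u⟫` for `v` uniform on the sphere depend only on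
`‖u‖`. -/
theorem integral_inner_pow_congr {d : ℕ} (m : ℕ) {u w : Space d} (h : ‖u‖ = ‖w‖) :
    ∫ v : UnitSphere d, ⟪(v : Space d), u⟫ ^ m ∂(uniformSphere d)
      = ∫ v : UnitSphere d, ⟪(v : Space d), w⟫ ^ m ∂(uniformSphere d) := by
  set g : Space d ≃ₗᵢ[ℝ] Space d := (ℝ ∙ (u - w))ᗮ.reflection
  have hg : g u = w := Submodule.reflection_sub h
  have hm := measurable_sphereMap g
  conv_rhs => rw [← map_sphereMap_uniformSphere g]
  rw [integral_map hm.aemeasurable (Continuous.aestronglyMeasurable (by fun_prop))]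
  refine integral_congr_ae (Filter.Eventually.of_forall fun v => ?_)
  simp only [sphereMap]
  rw [← hg, g.inner_map_map]

theorem integral_inner_odd_pow_eq_zero {d : ℕ} {m : ℕ} (hm : Odd m) (u : Space d) :
    ∫ v : UnitSphere d, ⟪(v : Space d), u⟫ ^ m ∂(uniformSphere d) = 0 := by
  have h := integral_inner_pow_congr m (norm_neg u)
  simp only [inner_neg_right, hm.neg_pow, integral_neg] at h
  linarith

theorem integral_inner_pow_nonneg {d : ℕ} (m : ℕ) (u : Space d) :
    0 ≤ ∫ v : UnitSphere d, ⟪(v : Space d), u⟫ ^ m ∂(uniformSphere d) := by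
  rcases Nat.even_or_odd m with hm | hm
  · exact integral_nonneg fun v => hm.pow_nonneg _
  · exact (integral_inner_odd_pow_eq_zero hm u).ge

theorem integral_norm_sq_stdGaussian (d : ℕ) :
    Integrable (fun y : Space d => ‖y‖ ^ 2) (stdGaussian (Space d)) ∧
    ∫ y : Space d, ‖y‖ ^ 2 ∂(stdGaussian (Space d)) = d := by
  have hi : ∀ a : Fin d, Integrable (fun y : Space d => (y a) ^ 2) (stdGaussian (Space d)) ∧
      ∫ y : Space d, (y a) ^ 2 ∂(stdGaussian (Space d)) = 1 := by
    intro a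
    have hn : ‖(EuclideanSpace.single a 1 : Space d)‖ = 1 := by simp
    have hm := map_inner_stdGaussian hn
    have e : (fun y : Space d => ⟪y, EuclideanSpace.single a (1 : ℝ)⟫) = fun y => y a := by
      ext y; simp [EuclideanSpace.inner_single_right]
    rw [e] at hm
    have hv : ∫ x, x ^ 2 ∂(gaussianReal 0 1) = 1 := by
      have := integral_X_mul_gaussianReal Polynomial.X
      simpa [pow_two] using this
    have hi := hasMoments_gaussianReal 2
    rw [← hm] at hv hi
    rw [integrable_map_measure (by fun_prop) (by fun_prop)] at hi
    rw [integral_map (by fun_prop) (by fun_prop)] at hv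
    exact ⟨hi, hv⟩
  simp only [EuclideanSpace.real_norm_sq_eq]
  refine ⟨integrable_finsetSum _ fun a _ => (hi a).1, ?_⟩
  rw [integral_finsetSum _ fun a _ => (hi a).1]
  simp [hi]

theorem integrable_norm_pow_stdGaussian (d k : ℕ) :
    Integrable (fun y : Space d => ‖y‖ ^ k) (stdGaussian (Space d)) := by
  have := (IsGaussian.memLp_id (stdGaussian (Space d)) k (by simp)).integrable_norm_pow'
  simpa using this

theorem pow_le_integral_norm_pow (d m : ℕ) :
    (d : ℝ) ^ m ≤ ∫ y : Space d, ‖y‖ ^ (2 * m) ∂(stdGaussian (Space d)) := by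
  have hJ := (convexOn_pow m).map_integral_le (μ := stdGaussian (Space d))
    (f := fun y => ‖y‖ ^ 2) (continuousOn_pow m) isClosed_Ici
    (Filter.Eventually.of_forall fun y => by simp) (integral_norm_sq_stdGaussian d).1
    (by
      have := integrable_norm_pow_stdGaussian d (2 * m)
      simpa [Function.comp_def, ← pow_mul] using this)
  rw [(integral_norm_sq_stdGaussian d).2] at hJ
  simpa [← pow_mul] using hJ

/-- The moments of a coordinate on the sphere are the Gaussian ones divided by `E ‖y‖ ^ (2 m)`, where
`y` is standard Gaussian: by rotation invariance, averaging over `v` or over `y` first in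
`E ⟪v, y⟫ ^ (2 m)` gives the two sides of this identity. -/
theorem integral_inner_even_pow_le {d : ℕ} (hd : 0 < d) (m : ℕ) {u : Space d} (hu : ‖u‖ = 1) :
    ∫ v : UnitSphere d, ⟪(v : Space d), u⟫ ^ (2 * m) ∂(uniformSphere d)
      ≤ (2 * m / d : ℝ) ^ m := by
  have := isProbabilityMeasure_uniformSphere hd
  set M := ∫ v : UnitSphere d, ⟪(v : Space d), u⟫ ^ (2 * m) ∂(uniformSphere d)
  have h0 : 0 ≤ M := integral_nonneg fun v => (even_two_mul m).pow_nonneg _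
  have hM : ∀ y : Space d,
      ∫ v : UnitSphere d, ⟪(v : Space d), y⟫ ^ (2 * m) ∂(uniformSphere d) = ‖y‖ ^ (2 * m) * M := by
    intro y
    have h : ‖y‖ = ‖(‖y‖ • u)‖ := by rw [norm_smul, hu]; simp
    rw [integral_inner_pow_congr _ h]
    simp only [real_inner_smul_right, mul_pow]
    rw [integral_const_mul]
  have hint : Integrable (fun p : UnitSphere d × Space d => ⟪(p.1 : Space d), p.2⟫ ^ (2 * m))
      ((uniformSphere d).prod (stdGaussian (Space d))) := by
    refine ((integrable_norm_pow_stdGaussian d (2 * m)).comp_snd (uniformSphere d)).mono'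
      (Continuous.aestronglyMeasurable (by fun_prop)) (Filter.Eventually.of_forall fun p => ?_)
    rw [norm_pow]
    refine pow_le_pow_left₀ (norm_nonneg _) ?_ _
    simpa using norm_inner_le_norm (𝕜 := ℝ) (p.1 : Space d) p.2
  have hswap := integral_integral_swap
    (f := fun (v : UnitSphere d) (y : Space d) => ⟪(v : Space d), y⟫ ^ (2 * m)) hint
  have hl : ∀ v : UnitSphere d,
      ∫ y : Space d, ⟪(v : Space d), y⟫ ^ (2 * m) ∂(stdGaussian (Space d))
      = ∫ x, x ^ (2 * m) ∂(gaussianReal 0 1) := by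
    intro v
    rw [← map_inner_stdGaussian (v := (v : Space d)) (by simp), integral_map (by fun_prop)
      (by fun_prop)]
    simp only [real_inner_comm]
  simp only [hM, hl, integral_const, probReal_univ, one_smul] at hswap
  rw [integral_mul_const] at hswap
  have hdm : (0 : ℝ) < (d : ℝ) ^ m := by positivity
  rw [div_pow, le_div_iff₀ hdm, mul_comm]
  calc (d : ℝ) ^ m * M ≤ (∫ y : Space d, ‖y‖ ^ (2 * m) ∂(stdGaussian (Space d))) * M := by
        gcongr; exact pow_le_integral_norm_pow d m
    _ = _ := hswap.symm
    _ ≤ _ := integral_even_pow_gaussianReal_le m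

theorem integral_inner_pow_le {d D m : ℕ} (hd : 0 < d) (hm : m ≤ D) {u : Space d} (hu : ‖u‖ = 1) :
    ∫ v : UnitSphere d, ⟪(v : Space d), u⟫ ^ m ∂(uniformSphere d) ≤ √(D / d : ℝ) ^ m := by
  rcases Nat.even_or_odd' m with ⟨k, rfl | rfl⟩
  · refine (integral_inner_even_pow_le hd k hu).trans ?_
    rw [pow_mul, Real.sq_sqrt (by positivity)]
    have : (2 * k : ℝ) ≤ D := by exact_mod_cast hm
    gcongr
  · rw [integral_inner_odd_pow_eq_zero ⟨k, rfl⟩]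
    positivity

/-! ### Polynomials under a law with a hidden direction -/

theorem integrable_one_add_pow {Ω : Type*} [MeasurableSpace Ω] {μ : Measure Ω} {X : Ω → ℝ}
    (hX : ∀ k : ℕ, Integrable (fun ω => X ω ^ k) μ) (m : ℕ) :
    Integrable (fun ω => (1 + X ω) ^ m) μ := by
  simp only [add_pow, one_pow, one_mul]
  exact integrable_finsetSum _ fun k _ => (hX _).mul_const _

theorem HasMoments.integrable_abs_pow {μ : Measure ℝ} (hμ : HasMoments μ) (k : ℕ) :
    Integrable (fun x : ℝ => |x| ^ k) μ := by
  simpa [abs_pow] using (hμ k).abs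

/-- The radial majorant `(1 + 2 ‖z‖) (1 + |t|)` of `1 + ‖replaceCoord v (z, t)‖`, which does not
depend on the unit vector `v`, has finite moments. -/
theorem integrable_majorant {d : ℕ} {ν : Measure ℝ} [SFinite ν] (hν : HasMoments ν) (m : ℕ) :
    Integrable (fun p : Space d × ℝ => ((1 + 2 * ‖p.1‖) * (1 + |p.2|)) ^ m)
      ((stdGaussian (Space d)).prod ν) := by
  simp only [mul_pow]
  refine Integrable.mul_prod (f := fun z : Space d => (1 + 2 * ‖z‖) ^ m)
    (g := fun t : ℝ => (1 + |t|) ^ m) (integrable_one_add_pow (fun k => ?_) m)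
    (integrable_one_add_pow (fun k => hν.integrable_abs_pow k) m)
  simp only [mul_pow]
  exact (integrable_norm_pow_stdGaussian d k).const_mul _

theorem one_add_norm_replaceCoord_le {d : ℕ} {v : Space d} (hv : ‖v‖ = 1) (p : Space d × ℝ) :
    1 + ‖replaceCoord v p‖ ≤ (1 + 2 * ‖p.1‖) * (1 + |p.2|) := by
  have h := norm_replaceCoord_le hv p
  have : 0 ≤ ‖p.1‖ * |p.2| := by positivity
  nlinarith

theorem integrable_one_add_norm_pow_hiddenLaw {d : ℕ} {ν : Measure ℝ} [SFinite ν]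
    (hν : HasMoments ν) {v : Space d} (hv : ‖v‖ = 1) (m : ℕ) :
    Integrable (fun y => (1 + ‖y‖) ^ m) (hiddenLaw ν v) := by
  rw [hiddenLaw, integrable_map_measure (by fun_prop) (by fun_prop)]
  refine (integrable_majorant hν m).mono' (Measurable.aestronglyMeasurable (by fun_prop))
    (Filter.Eventually.of_forall fun p => ?_)
  simp only [Function.comp_apply]
  rw [Real.norm_of_nonneg (by positivity)]
  exact pow_le_pow_left₀ (by positivity) (one_add_norm_replaceCoord_le hv p) m

theorem integral_one_add_norm_pow_hiddenLaw_le {d : ℕ} {ν : Measure ℝ} [SFinite ν]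
    (hν : HasMoments ν) {v : Space d} (hv : ‖v‖ = 1) (m : ℕ) :
    ∫ y, (1 + ‖y‖) ^ m ∂(hiddenLaw ν v)
      ≤ ∫ p, ((1 + 2 * ‖p.1‖) * (1 + |p.2|)) ^ m ∂((stdGaussian (Space d)).prod ν) := by
  rw [integral_hiddenLaw _ _ (by fun_prop)]
  refine integral_mono_of_nonneg (Filter.Eventually.of_forall fun p => ?_)
    (integrable_majorant hν m) (Filter.Eventually.of_forall fun p => ?_)
  · simp only [Pi.zero_apply]
    positivity
  · exact pow_le_pow_left₀ (by positivity) (one_add_norm_replaceCoord_le hv p) m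

theorem integrable_one_add_norm_pow_stdGaussian (d m : ℕ) :
    Integrable (fun y : Space d => (1 + ‖y‖) ^ m) (stdGaussian (Space d)) :=
  integrable_one_add_pow (fun k => integrable_norm_pow_stdGaussian d k) m

/-- `F` is a continuous function with at most polynomial growth. -/
def PolyGrowth {d : ℕ} (F : Space d → ℝ) : Prop :=
  Continuous F ∧ ∃ (c : ℝ) (m : ℕ), ∀ y, |F y| ≤ c * (1 + ‖y‖) ^ m

theorem PolyGrowth.mul {d : ℕ} {F G : Space d → ℝ} (hF : PolyGrowth F) (hG : PolyGrowth G) :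
    PolyGrowth fun y => F y * G y := by
  obtain ⟨hF0, a, m, hF⟩ := hF
  obtain ⟨hG0, b, l, hG⟩ := hG
  refine ⟨hF0.mul hG0, a * b, m + l, fun y => ?_⟩
  rw [abs_mul, pow_add]
  calc |F y| * |G y| ≤ (a * (1 + ‖y‖) ^ m) * (b * (1 + ‖y‖) ^ l) :=
        mul_le_mul (hF y) (hG y) (abs_nonneg _) ((abs_nonneg _).trans (hF y))
    _ = _ := by ring

theorem PolyGrowth.integrable_hiddenLaw {d : ℕ} {F : Space d → ℝ} (hF : PolyGrowth F)
    {ν : Measure ℝ} [SFinite ν] (hν : HasMoments ν) {v : Space d} (hv : ‖v‖ = 1) :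
    Integrable F (hiddenLaw ν v) := by
  obtain ⟨hF0, c, m, hF⟩ := hF
  exact ((integrable_one_add_norm_pow_hiddenLaw hν hv m).const_mul c).mono'
    hF0.aestronglyMeasurable (Filter.Eventually.of_forall hF)

theorem PolyGrowth.integrable_stdGaussian {d : ℕ} {F : Space d → ℝ} (hF : PolyGrowth F) :
    Integrable F (stdGaussian (Space d)) := by
  obtain ⟨hF0, c, m, hF⟩ := hF
  exact ((integrable_one_add_norm_pow_stdGaussian d m).const_mul c).mono'
    hF0.aestronglyMeasurable (Filter.Eventually.of_forall hF)

theorem abs_eval_le (P : Polynomial ℝ) (x : ℝ) :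
    |P.eval x| ≤ (∑ k ∈ Finset.range (P.natDegree + 1), |P.coeff k|) * (1 + |x|) ^ P.natDegree := by
  rw [Polynomial.eval_eq_sum_range, Finset.sum_mul]
  refine (Finset.abs_sum_le_sum_abs _ _).trans (Finset.sum_le_sum fun k hk => ?_)
  rw [abs_mul, abs_pow]
  have h1 : |x| ^ k ≤ (1 + |x|) ^ k := pow_le_pow_left₀ (abs_nonneg _) (by linarith) k
  have h2 : (1 + |x|) ^ k ≤ (1 + |x|) ^ P.natDegree :=
    pow_le_pow_right₀ (by linarith [abs_nonneg x]) (by simp at hk; omega)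
  gcongr
  exact h1.trans h2

theorem abs_eval_inner_le {d : ℕ} (P : Polynomial ℝ) {v : Space d} (hv : ‖v‖ = 1) (y : Space d) :
    |P.eval ⟪y, v⟫|
      ≤ (∑ k ∈ Finset.range (P.natDegree + 1), |P.coeff k|) * (1 + ‖y‖) ^ P.natDegree := by
  refine (abs_eval_le P _).trans ?_
  have : |⟪y, v⟫| ≤ ‖y‖ := by simpa [hv] using abs_real_inner_le_norm y v
  gcongr

theorem polyGrowth_eval_inner {d : ℕ} (P : Polynomial ℝ) {v : Space d} (hv : ‖v‖ = 1) :
    PolyGrowth fun y : Space d => P.eval ⟪y, v⟫ :=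
  ⟨by fun_prop, _, _, abs_eval_inner_le P hv⟩

theorem abs_monomial_le {d : ℕ} (e : Fin d → ℕ) (y : Space d) :
    |∏ a, (y a) ^ e a| ≤ (1 + ‖y‖) ^ ∑ a, e a := by
  rw [Finset.abs_prod, ← Finset.prod_pow_eq_pow_sum]
  refine Finset.prod_le_prod (fun a _ => abs_nonneg _) fun a _ => ?_
  rw [abs_pow]
  refine pow_le_pow_left₀ (abs_nonneg _) ?_ _
  have := PiLp.norm_apply_le y a
  rw [Real.norm_eq_abs] at this
  linarith

theorem polyGrowth_monomial {d : ℕ} (e : Fin d → ℕ) :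
    PolyGrowth fun y : Space d => ∏ a, (y a) ^ e a :=
  ⟨by fun_prop, 1, ∑ a, e a, fun y => by simpa using abs_monomial_le e y⟩

/-- On every line of direction `v`, the function `F` is a polynomial of degree at most `K`. -/
def PolyAlong {d : ℕ} (v : Space d) (K : ℕ) (F : Space d → ℝ) : Prop :=
  ∀ z : Space d, ∃ P : Polynomial ℝ, P.natDegree ≤ K ∧ ∀ t, F (replaceCoord v (z, t)) = P.eval t

theorem PolyAlong.mono {d : ℕ} {v : Space d} {K L : ℕ} {F : Space d → ℝ} (h : PolyAlong v K F)
    (hKL : K ≤ L) : PolyAlong v L F := fun z => by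
  obtain ⟨P, hP, hPF⟩ := h z
  exact ⟨P, hP.trans hKL, hPF⟩

theorem polyAlong_monomial {d : ℕ} (v : Space d) (e : Fin d → ℕ) :
    PolyAlong v (∑ a, e a) fun y => ∏ a, (y a) ^ e a := by
  intro z
  refine ⟨∏ a, (Polynomial.C (v a) * Polynomial.X + Polynomial.C (z a - ⟪z, v⟫ * v a)) ^ e a,
    ?_, fun t => ?_⟩
  · refine (Polynomial.natDegree_prod_le _ _).trans (Finset.sum_le_sum fun a _ => ?_)
    exact (Polynomial.natDegree_pow_le_of_le (e a) Polynomial.natDegree_linear_le).trans (by simp)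
  · rw [Polynomial.eval_prod]
    refine Finset.prod_congr rfl fun a _ => ?_
    simp [replaceCoord]
    ring

theorem integral_stdGaussian_eq_integral_integral {d : ℕ} {v : Space d} (hv : ‖v‖ = 1)
    {F : Space d → ℝ} (hF : PolyGrowth F) :
    ∫ y, F y ∂(stdGaussian (Space d))
      = ∫ z, ∫ s, F (replaceCoord v (z, s)) ∂(gaussianReal 0 1) ∂(stdGaussian (Space d)) := by
  have h := hF.integrable_hiddenLaw hasMoments_gaussianReal hv
  rw [hiddenLaw, integrable_map_measure hF.1.aestronglyMeasurable (by fun_prop)] at h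
  conv_lhs => rw [← hiddenLaw_gaussianReal hv]
  rw [integral_hiddenLaw _ _ hF.1.measurable, integral_prod (fun p => F (replaceCoord v p)) h]

theorem integral_hermiteNorm_inner_mul_eq_zero {d : ℕ} {v : Space d} (hv : ‖v‖ = 1)
    {F : Space d → ℝ} (hF : PolyGrowth F) {k K : ℕ} (hFv : PolyAlong v K F) (hk : K < k) :
    ∫ y, (hermiteNorm k).eval ⟪y, v⟫ * F y ∂(stdGaussian (Space d)) = 0 := by
  rw [integral_stdGaussian_eq_integral_integral hv ((polyGrowth_eval_inner _ hv).mul hF)]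
  refine integral_eq_zero_of_ae (Filter.Eventually.of_forall fun z => ?_)
  obtain ⟨P, hP, hPF⟩ := hFv z
  simp only [inner_replaceCoord_self hv, hPF]
  exact integral_hermiteNorm_mul_of_lt (hP.trans_lt hk)

/-- For a function that is a polynomial of degree at most `K` along `v`, the law `hiddenLaw ν v`
has with respect to the standard Gaussian the density `∑ k ≤ K, E_ν[h_k] h_k(⟪·, v⟫)`. -/
theorem integral_hiddenLaw_eq_sum {d : ℕ} {v : Space d} (hv : ‖v‖ = 1) {ν : Measure ℝ} [SFinite ν]
    (hν : HasMoments ν) {F : Space d → ℝ} (hF : PolyGrowth F) {K : ℕ} (hFv : PolyAlong v K F) :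
    ∫ y, F y ∂(hiddenLaw ν v) = ∑ k ∈ Finset.range (K + 1), (∫ x, (hermiteNorm k).eval x ∂ν) *
      ∫ y, (hermiteNorm k).eval ⟪y, v⟫ * F y ∂(stdGaussian (Space d)) := by
  have h := hF.integrable_hiddenLaw hν hv
  rw [hiddenLaw, integrable_map_measure hF.1.aestronglyMeasurable (by fun_prop)] at h
  rw [integral_hiddenLaw _ _ hF.1.measurable, integral_prod (fun p => F (replaceCoord v p)) h]
  have e : ∀ z, ∫ t, F (replaceCoord v (z, t)) ∂ν = ∑ k ∈ Finset.range (K + 1),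
      (∫ x, (hermiteNorm k).eval x ∂ν) *
        ∫ s, (hermiteNorm k).eval s * F (replaceCoord v (z, s)) ∂(gaussianReal 0 1) := by
    intro z
    obtain ⟨P, hP, hPF⟩ := hFv z
    simp only [hPF]
    exact integral_eval_eq_sum hν P hP
  have hk : ∀ k, PolyGrowth fun y => (hermiteNorm k).eval ⟪y, v⟫ * F y := fun k =>
    (polyGrowth_eval_inner _ hv).mul hF
  simp only [e]
  rw [integral_finsetSum]
  · refine Finset.sum_congr rfl fun k _ => ?_
    rw [integral_const_mul, integral_stdGaussian_eq_integral_integral hv (hk k)]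
    simp only [inner_replaceCoord_self hv]
  · intro k _
    refine Integrable.const_mul ?_ _
    have h2 := (hk k).integrable_hiddenLaw hasMoments_gaussianReal hv
    rw [hiddenLaw, integrable_map_measure (hk k).1.aestronglyMeasurable (by fun_prop)] at h2
    have h3 := h2.integral_prod_left
    simpa only [Function.comp_apply, inner_replaceCoord_self hv] using h3

theorem inner_replaceCoord {d : ℕ} (v w z : Space d) (t : ℝ) :
    ⟪replaceCoord v (z, t), w⟫ = ⟪v, w⟫ * t + (⟪z, w⟫ - ⟪z, v⟫ * ⟪v, w⟫) := by
  rw [replaceCoord, inner_add_left, real_inner_smul_left]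
  ring

theorem polyAlong_eval_inner {d : ℕ} (v w : Space d) (P : Polynomial ℝ) :
    PolyAlong v P.natDegree fun y => P.eval ⟪y, w⟫ := by
  intro z
  refine ⟨P.comp (Polynomial.C ⟪v, w⟫ * Polynomial.X
    + Polynomial.C (⟪z, w⟫ - ⟪z, v⟫ * ⟪v, w⟫)), ?_, fun t => ?_⟩
  · rw [Polynomial.natDegree_comp]
    exact (Nat.mul_le_mul_left _ Polynomial.natDegree_linear_le).trans (by simp)
  · simp [inner_replaceCoord]

theorem coeff_comp_linear {P : Polynomial ℝ} {k : ℕ} (hP : P.natDegree ≤ k) (a b : ℝ) :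
    (P.comp (Polynomial.C a * Polynomial.X + Polynomial.C b)).coeff k = a ^ k * P.coeff k := by
  have e : P.comp (Polynomial.C a * Polynomial.X + Polynomial.C b)
      = (P.taylor b).comp (Polynomial.C a * Polynomial.X) := by
    rw [Polynomial.taylor_apply, Polynomial.comp_assoc]
    simp
  rw [e, Polynomial.comp_C_mul_X_coeff, mul_comm]
  congr 1
  rw [Polynomial.taylor_coeff, Polynomial.hasseDeriv_apply,
    Polynomial.sum_over_range' _ (by simp) (k + 1) (by omega), Finset.sum_range_succ,
    Finset.sum_eq_zero]
  · simp
  · intro m hm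
    simp [Nat.choose_eq_zero_of_lt (Finset.mem_range.1 hm)]

theorem integral_hermiteNorm_inner_mul_hermiteNorm_inner {d : ℕ} {v w : Space d} (hv : ‖v‖ = 1)
    (hw : ‖w‖ = 1) (k l : ℕ) :
    ∫ y, (hermiteNorm k).eval ⟪y, v⟫ * (hermiteNorm l).eval ⟪y, w⟫ ∂(stdGaussian (Space d))
      = if k = l then ⟪v, w⟫ ^ k else 0 := by
  have hlt : ∀ {v w : Space d} (_ : ‖v‖ = 1) (_ : ‖w‖ = 1) {k l : ℕ}, l < k →
      ∫ y, (hermiteNorm k).eval ⟪y, v⟫ * (hermiteNorm l).eval ⟪y, w⟫ ∂(stdGaussian (Space d))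
        = 0 := fun {v w} hv hw {k l} hkl =>
    integral_hermiteNorm_inner_mul_eq_zero hv (polyGrowth_eval_inner _ hw)
      (polyAlong_eval_inner v w _) (by rwa [natDegree_hermiteNorm])
  rcases lt_trichotomy k l with h | h | h
  · rw [if_neg h.ne]
    simp only [mul_comm ((hermiteNorm k).eval _)]
    exact hlt hw hv h
  · subst h
    rw [if_pos rfl, integral_stdGaussian_eq_integral_integral hv
      ((polyGrowth_eval_inner _ hv).mul (polyGrowth_eval_inner _ hw))]
    have e : ∀ z : Space d, ∫ s, (hermiteNorm k).eval ⟪replaceCoord v (z, s), v⟫ *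
        (hermiteNorm k).eval ⟪replaceCoord v (z, s), w⟫ ∂(gaussianReal 0 1) = ⟪v, w⟫ ^ k := by
      intro z
      have hdeg : ((hermiteNorm k).comp (Polynomial.C ⟪v, w⟫ * Polynomial.X
          + Polynomial.C (⟪z, w⟫ - ⟪z, v⟫ * ⟪v, w⟫))).natDegree ≤ k := by
        rw [Polynomial.natDegree_comp, natDegree_hermiteNorm]
        exact (Nat.mul_le_mul_left _ Polynomial.natDegree_linear_le).trans (by simp)
      have h := integral_hermiteNorm_mul hdeg
      rw [coeff_comp_linear (natDegree_hermiteNorm_le k), coeff_hermiteNorm_self] at h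
      have h3 : √(k.factorial : ℝ) ≠ 0 := by positivity
      rw [mul_left_comm, mul_inv_cancel₀ h3, mul_one] at h
      rw [← h]
      refine integral_congr_ae (Filter.Eventually.of_forall fun s => ?_)
      simp [inner_replaceCoord_self hv, inner_replaceCoord v w]
    simp only [e]
    simp
  · rw [if_neg h.ne']
    exact hlt hv hw h

/-! ### Cauchy–Schwarz for mixtures -/

theorem sq_integral_mul_le {Y : Type*} [MeasurableSpace Y] {ν : Measure Y} {f g : Y → ℝ}
    (hff : Integrable (fun y => f y ^ 2) ν) (hgg : Integrable (fun y => g y ^ 2) ν)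
    (hfg : Integrable (fun y => f y * g y) ν) :
    (∫ y, f y * g y ∂ν) ^ 2 ≤ (∫ y, f y ^ 2 ∂ν) * ∫ y, g y ^ 2 ∂ν := by
  have h : ∀ t : ℝ, 0 ≤ (∫ y, f y ^ 2 ∂ν) * (t * t) + (2 * ∫ y, f y * g y ∂ν) * t
      + ∫ y, g y ^ 2 ∂ν := by
    intro t
    have h1 : ∫ y, (t * f y + g y) ^ 2 ∂ν = (∫ y, f y ^ 2 ∂ν) * (t * t)
        + (2 * ∫ y, f y * g y ∂ν) * t + ∫ y, g y ^ 2 ∂ν := by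
      have e : ∀ y, (t * f y + g y) ^ 2 = f y ^ 2 * (t * t) + (2 * t) * (f y * g y) + g y ^ 2 :=
        fun y => by ring
      simp only [e]
      have i1 := hff.mul_const (t * t)
      have i2 := hfg.const_mul (2 * t)
      rw [integral_add (f := fun y => f y ^ 2 * (t * t) + (2 * t) * (f y * g y)) (i1.add i2) hgg,
        integral_add i1 i2, integral_mul_const, integral_const_mul]
      ring
    rw [← h1]
    exact integral_nonneg fun y => sq_nonneg _
  have := discrim_le_zero h
  rw [discrim] at this
  nlinarith

theorem integrable_mul_of_sq {Y : Type*} [MeasurableSpace Y] {ν : Measure Y} {f g : Y → ℝ}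
    (hf : AEStronglyMeasurable f ν) (hg : AEStronglyMeasurable g ν)
    (hff : Integrable (fun y => f y ^ 2) ν) (hgg : Integrable (fun y => g y ^ 2) ν) :
    Integrable (fun y => f y * g y) ν := by
  refine (hff.add hgg).mono' (hf.mul hg) (Filter.Eventually.of_forall fun y => ?_)
  rw [Real.norm_eq_abs, abs_le]
  simp only [Pi.add_apply]
  constructor <;> nlinarith [sq_nonneg (f y + g y), sq_nonneg (f y - g y), sq_nonneg (f y),
    sq_nonneg (g y)]

section Mixture

variable {V Y : Type*} [MeasurableSpace V] [MeasurableSpace Y] {μ : Measure V}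
  [IsProbabilityMeasure μ] {ν : Measure Y} [SFinite ν] {L : V → Y → ℝ} {U : Y → ℝ}

/-- The density of a mixture is the average of the densities. -/
theorem integral_integral_mul_eq (hL : Measurable (Function.uncurry L)) (hU : Measurable U)
    (hLU : ∀ v y, |L v y| ≤ U y) (hUU : Integrable (fun y => U y ^ 2) ν) {f : Y → ℝ}
    (hf : AEStronglyMeasurable f ν) (hff : Integrable (fun y => f y ^ 2) ν) :
    ∫ v, ∫ y, L v y * f y ∂ν ∂μ = ∫ y, (∫ v, L v y ∂μ) * f y ∂ν := by
  have hUf := (integrable_mul_of_sq hU.aestronglyMeasurable hf hUU hff).norm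
  have hint : Integrable (Function.uncurry fun v y => L v y * f y) (μ.prod ν) := by
    refine (hUf.comp_snd μ).mono' (hL.aestronglyMeasurable.mul hf.comp_snd)
      (Filter.Eventually.of_forall fun p => ?_)
    simp only [Function.uncurry, norm_mul, Real.norm_eq_abs]
    exact mul_le_mul_of_nonneg_right ((hLU _ _).trans (le_abs_self _)) (abs_nonneg _)
  rw [integral_integral_swap hint]
  simp only [integral_mul_const]

/-- The Cauchy–Schwarz inequality for the mixture of the densities `L v`. The second moment of the
mixture is written as a double integral over two replicas. -/
theorem sq_integral_integral_mul_le (hL : Measurable (Function.uncurry L)) (hU : Measurable U)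
    (hLU : ∀ v y, |L v y| ≤ U y) (hUU : Integrable (fun y => U y ^ 2) ν) {f : Y → ℝ}
    (hf : AEStronglyMeasurable f ν) (hff : Integrable (fun y => f y ^ 2) ν) :
    (∫ v, ∫ y, L v y * f y ∂ν ∂μ) ^ 2
      ≤ (∫ v, ∫ w, ∫ y, L v y * L w y ∂ν ∂μ ∂μ) * ∫ y, f y ^ 2 ∂ν := by
  set Φ : Y → ℝ := fun y => ∫ v, L v y ∂μ
  have hΦm : StronglyMeasurable Φ := by
    have : StronglyMeasurable (Function.uncurry fun y v => L v y) :=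
      (hL.comp measurable_swap).stronglyMeasurable
    exact this.integral_prod_right
  have hΦU : ∀ y, |Φ y| ≤ U y := fun y => by
    have := norm_integral_le_of_norm_le_const (μ := μ) (f := fun v => L v y) (C := U y)
      (Filter.Eventually.of_forall fun v => hLU v y)
    simpa using this
  have hsq : ∀ {g : Y → ℝ}, AEStronglyMeasurable g ν → (∀ y, |g y| ≤ U y) →
      Integrable (fun y => g y ^ 2) ν := by
    intro g hg hgU
    refine hUU.mono' (hg.pow 2) (Filter.Eventually.of_forall fun y => ?_)
    rw [norm_pow, Real.norm_eq_abs]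
    exact pow_le_pow_left₀ (abs_nonneg _) (hgU y) 2
  have hLm : ∀ v, AEStronglyMeasurable (L v) ν := fun v =>
    (hL.comp measurable_prodMk_left).aestronglyMeasurable
  have hΦ2 := hsq hΦm.aestronglyMeasurable hΦU
  have e : ∫ v, ∫ w, ∫ y, L v y * L w y ∂ν ∂μ ∂μ = ∫ y, Φ y ^ 2 ∂ν := by
    have e1 : ∀ v, ∫ w, ∫ y, L v y * L w y ∂ν ∂μ = ∫ y, L v y * Φ y ∂ν := by
      intro v
      have := integral_integral_mul_eq (μ := μ) hL hU hLU hUU (hLm v) (hsq (hLm v) (hLU v))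
      simp only [mul_comm (L v _)]
      exact this
    simp only [e1]
    rw [integral_integral_mul_eq hL hU hLU hUU hΦm.aestronglyMeasurable hΦ2]
    simp only [pow_two, Φ]
  rw [e, integral_integral_mul_eq hL hU hLU hUU hf hff]
  exact sq_integral_mul_le hΦ2 hff
    (integrable_mul_of_sq hΦm.aestronglyMeasurable hf hΦ2 hff)

end Mixture

/-! ### The likelihood ratio of a sample -/

theorem evalSample_eq_sum {d n : ℕ} (f : MvPolynomial (Fin n × Fin d) ℝ) (y : Fin n → Space d) :
    evalSample f y = ∑ m ∈ f.support, f.coeff m * ∏ j, ∏ a, (y j a) ^ m (j, a) := by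
  rw [evalSample, MvPolynomial.eval_eq']
  refine Finset.sum_congr rfl fun m _ => ?_
  rw [Fintype.prod_prod_type]

theorem sum_degree_le {d n D : ℕ} {f : MvPolynomial (Fin n × Fin d) ℝ} (hf : f.totalDegree ≤ D)
    {m : Fin n × Fin d →₀ ℕ} (hm : m ∈ f.support) : ∑ j, ∑ a, m (j, a) ≤ D := by
  have h := (MvPolynomial.le_totalDegree hm).trans hf
  rw [Finsupp.sum_fintype _ _ fun _ => rfl, Fintype.sum_prod_type] at h
  exact h

/-- `F` is a continuous function of the sample, bounded by a multiple of a power of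
`∏ j, (1 + ‖y j‖)`. -/
def SampleGrowth {d n : ℕ} (F : (Fin n → Space d) → ℝ) : Prop :=
  Continuous F ∧ ∃ (c : ℝ) (m : ℕ), 0 ≤ c ∧ ∀ y, |F y| ≤ c * ∏ j, (1 + ‖y j‖) ^ m

theorem continuous_evalSample {d n : ℕ} (f : MvPolynomial (Fin n × Fin d) ℝ) :
    Continuous (evalSample f) := by
  have : evalSample f = fun y => _ := funext (evalSample_eq_sum f)
  rw [this]
  fun_prop

theorem sampleGrowth_evalSample {d n : ℕ} (f : MvPolynomial (Fin n × Fin d) ℝ) :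
    SampleGrowth (evalSample f) := by
  refine ⟨continuous_evalSample f, ∑ m ∈ f.support, |f.coeff m|, f.totalDegree,
    Finset.sum_nonneg fun _ _ => abs_nonneg _, fun y => ?_⟩
  rw [evalSample_eq_sum, Finset.sum_mul]
  refine (Finset.abs_sum_le_sum_abs _ _).trans (Finset.sum_le_sum fun m hm => ?_)
  rw [abs_mul, Finset.abs_prod]
  refine mul_le_mul_of_nonneg_left (Finset.prod_le_prod (fun _ _ => abs_nonneg _) fun j _ => ?_)
    (abs_nonneg _)
  refine (abs_monomial_le _ _).trans (pow_le_pow_right₀ (by linarith [norm_nonneg (y j)]) ?_)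
  exact (Finset.single_le_sum (f := fun j => ∑ a, m (j, a)) (fun _ _ => Nat.zero_le _)
    (Finset.mem_univ j)).trans (sum_degree_le le_rfl hm)

theorem SampleGrowth.mul {d n : ℕ} {F G : (Fin n → Space d) → ℝ} (hF : SampleGrowth F)
    (hG : SampleGrowth G) : SampleGrowth fun y => F y * G y := by
  obtain ⟨hF0, a, m, ha, hF⟩ := hF
  obtain ⟨hG0, b, l, hb, hG⟩ := hG
  refine ⟨hF0.mul hG0, a * b, m + l, mul_nonneg ha hb, fun y => ?_⟩
  simp only [abs_mul, pow_add, Finset.prod_mul_distrib]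
  calc |F y| * |G y| ≤ (a * ∏ j, (1 + ‖y j‖) ^ m) * (b * ∏ j, (1 + ‖y j‖) ^ l) :=
        mul_le_mul (hF y) (hG y) (abs_nonneg _) ((abs_nonneg _).trans (hF y))
    _ = _ := by ring

theorem SampleGrowth.integrable {d n : ℕ} {F : (Fin n → Space d) → ℝ} (hF : SampleGrowth F)
    {μ : Measure (Space d)} [SigmaFinite μ]
    (hμ : ∀ m : ℕ, Integrable (fun y => (1 + ‖y‖) ^ m) μ) :
    Integrable F (Measure.pi fun _ => μ) := by
  obtain ⟨hF0, c, m, hc, hF⟩ := hF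
  have h : Integrable (fun y : Fin n → Space d => ∏ j, (1 + ‖y j‖) ^ m) (Measure.pi fun _ => μ) :=
    Integrable.fintype_prod (f := fun _ (y : Space d) => (1 + ‖y‖) ^ m) fun _ => hμ m
  exact (h.const_mul c).mono' hF0.aestronglyMeasurable (Filter.Eventually.of_forall hF)

/-- The multi-indices `κ : Fin n → ℕ` of total degree at most `D`. -/
def multiIndices (n D : ℕ) : Finset (Fin n → ℕ) :=
  (Fintype.piFinset fun _ : Fin n => Finset.range (D + 1)).filter fun κ => ∑ j, κ j ≤ D

/-- The Hermite expansion, truncated at total degree `D`, of the likelihood ratio at the sample `y`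
of the i.i.d. law with hidden direction `v`, if `a k` is the `k`-th Hermite coefficient of
the law along `v`. -/
noncomputable def likelihood {d n : ℕ} (a : ℕ → ℝ) (D : ℕ) (v : Space d) (y : Fin n → Space d) :
    ℝ :=
  ∑ κ ∈ multiIndices n D, ∏ j, a (κ j) * (hermiteNorm (κ j)).eval ⟪y j, v⟫

theorem continuous_likelihood {d n : ℕ} (a : ℕ → ℝ) (D : ℕ) :
    Continuous fun p : Space d × (Fin n → Space d) => likelihood a D p.1 p.2 := by
  unfold likelihood
  fun_prop

/-- The likelihood ratio has polynomial growth, uniformly in the direction. -/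
theorem exists_abs_likelihood_le (d n : ℕ) (a : ℕ → ℝ) (D : ℕ) :
    ∃ c : ℝ, 0 ≤ c ∧ ∀ v : Space d, ‖v‖ = 1 → ∀ y : Fin n → Space d,
      |likelihood a D v y| ≤ c * ∏ j, (1 + ‖y j‖) ^ D := by
  refine ⟨∑ κ ∈ multiIndices n D, ∏ j : Fin n, |a (κ j)| *
    (∑ k ∈ Finset.range ((hermiteNorm (κ j)).natDegree + 1), |(hermiteNorm (κ j)).coeff k|),
    Finset.sum_nonneg fun _ _ => Finset.prod_nonneg fun _ _ =>
      mul_nonneg (abs_nonneg _) (Finset.sum_nonneg fun _ _ => abs_nonneg _), fun v hv y => ?_⟩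
  rw [likelihood, Finset.sum_mul]
  refine (Finset.abs_sum_le_sum_abs _ _).trans (Finset.sum_le_sum fun κ hκ => ?_)
  rw [Finset.abs_prod, ← Finset.prod_mul_distrib]
  refine Finset.prod_le_prod (fun _ _ => abs_nonneg _) fun j _ => ?_
  rw [abs_mul, mul_assoc]
  refine mul_le_mul_of_nonneg_left ((abs_eval_inner_le _ hv _).trans ?_) (abs_nonneg _)
  refine mul_le_mul_of_nonneg_left (pow_le_pow_right₀ (by linarith [norm_nonneg (y j)]) ?_)
    (Finset.sum_nonneg fun _ _ => abs_nonneg _)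
  rw [natDegree_hermiteNorm]
  simp only [multiIndices, Finset.mem_filter, Fintype.mem_piFinset, Finset.mem_range] at hκ
  exact Nat.lt_succ_iff.1 (hκ.1 j)

instance isProbabilityMeasure_hiddenLaw {d : ℕ} (ν : Measure ℝ) [IsProbabilityMeasure ν]
    (v : Space d) : IsProbabilityMeasure (hiddenLaw ν v) :=
  Measure.isProbabilityMeasure_map (by fun_prop)

/-- The case of a monomial `∏ j, ∏ b, (y j b) ^ m j b` of `integral_pi_hiddenLaw_eq`. -/
theorem integral_monomial_pi_hiddenLaw_eq {d n D : ℕ} {ν : Measure ℝ} [IsProbabilityMeasure ν]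
    (hν : HasMoments ν) {v : Space d} (hv : ‖v‖ = 1) {m : Fin n → Fin d → ℕ}
    (hdeg : ∑ j, ∑ b, m j b ≤ D) {a : ℕ → ℝ} (ha : ∀ k, ∫ x, (hermiteNorm k).eval x ∂ν = a k) :
    ∫ y : Fin n → Space d, ∏ j, ∏ b, (y j b) ^ m j b ∂(Measure.pi fun _ => hiddenLaw ν v)
      = ∑ κ ∈ multiIndices n D, ∫ y : Fin n → Space d,
        ∏ j, (a (κ j) * ((hermiteNorm (κ j)).eval ⟪y j, v⟫ * ∏ b, (y j b) ^ m j b))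
          ∂(nullLaw d n) := by
  have hj : ∀ j, ∑ b, m j b ≤ D := fun j =>
    (Finset.single_le_sum (f := fun j => ∑ b, m j b) (fun _ _ => Nat.zero_le _)
      (Finset.mem_univ j)).trans hdeg
  rw [integral_fintype_prod_eq_prod (f := fun j (y : Space d) => ∏ b, (y b) ^ m j b)]
  have h1 : ∀ j, ∫ y : Space d, ∏ b, (y b) ^ m j b ∂(hiddenLaw ν v)
      = ∑ k ∈ Finset.range (D + 1), ∫ y : Space d,
          a k * ((hermiteNorm k).eval ⟪y, v⟫ * ∏ b, (y b) ^ m j b)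
            ∂(stdGaussian (Space d)) := fun j => by
    simp only [integral_const_mul]
    rw [integral_hiddenLaw_eq_sum hv hν (polyGrowth_monomial _)
      ((polyAlong_monomial v _).mono (hj j))]
    simp only [ha]
  simp only [h1]
  rw [Finset.prod_univ_sum, multiIndices, Finset.sum_filter_of_ne]
  · refine Finset.sum_congr rfl fun κ _ => ?_
    rw [nullLaw, integral_fintype_prod_eq_prod (f := fun j (y : Space d) =>
      a (κ j) * ((hermiteNorm (κ j)).eval ⟪y, v⟫ * ∏ b, (y b) ^ m j b))]
  · intro κ _ hne
    -- if the total degree of `κ` exceeds `D`, then some `κ j` exceeds the degree of the monomial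
    -- in the `j`-th sample point, and the corresponding factor vanishes
    by_contra hlt
    obtain ⟨j, -, hjlt⟩ := Finset.exists_lt_of_sum_lt
      (hdeg.trans_lt (not_le.1 hlt))
    refine hne ?_
    rw [nullLaw, integral_fintype_prod_eq_prod (f := fun j (y : Space d) =>
      a (κ j) * ((hermiteNorm (κ j)).eval ⟪y, v⟫ * ∏ b, (y b) ^ m j b))]
    refine Finset.prod_eq_zero (Finset.mem_univ j) ?_
    rw [integral_const_mul, integral_hermiteNorm_inner_mul_eq_zero hv (polyGrowth_monomial _)
      (polyAlong_monomial v _) hjlt, mul_zero]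

instance isProbabilityMeasure_nullLaw (d n : ℕ) : IsProbabilityMeasure (nullLaw d n) := by
  unfold nullLaw
  infer_instance

/-- Testing a polynomial of degree at most `D` against the i.i.d. law with hidden direction `v` is
the same as testing it against the truncated likelihood ratio. -/
theorem integral_pi_hiddenLaw_eq {d n D : ℕ} {ν : Measure ℝ} [IsProbabilityMeasure ν]
    (hν : HasMoments ν) {v : Space d} (hv : ‖v‖ = 1) {f : MvPolynomial (Fin n × Fin d) ℝ}
    (hf : f.totalDegree ≤ D) :
    ∫ y, evalSample f y ∂(Measure.pi fun _ : Fin n => hiddenLaw ν v)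
      = ∫ y, likelihood (fun k => ∫ x, (hermiteNorm k).eval x ∂ν) D v y * evalSample f y
          ∂(nullLaw d n) := by
  set a : ℕ → ℝ := fun k => ∫ x, (hermiteNorm k).eval x ∂ν
  have hone : ∀ e : Fin d → ℕ, ∀ k, Integrable (fun y : Space d =>
      a k * ((hermiteNorm k).eval ⟪y, v⟫ * ∏ b, (y b) ^ e b)) (stdGaussian (Space d)) :=
    fun e k => (((polyGrowth_eval_inner _ hv).mul (polyGrowth_monomial e)).integrable_stdGaussian
      ).const_mul _
  have hint1 : ∀ m : Fin n × Fin d →₀ ℕ, Integrable (fun y : Fin n → Space d =>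
      ∏ j, ∏ b, (y j b) ^ m (j, b)) (Measure.pi fun _ => hiddenLaw ν v) := fun m =>
    Integrable.fintype_prod (f := fun j (y : Space d) => ∏ b, (y b) ^ m (j, b)) fun j =>
      (polyGrowth_monomial _).integrable_hiddenLaw hν hv
  have hint2 : ∀ (m : Fin n × Fin d →₀ ℕ) (κ : Fin n → ℕ), Integrable (fun y : Fin n → Space d =>
      ∏ j, (a (κ j) * ((hermiteNorm (κ j)).eval ⟪y j, v⟫ * ∏ b, (y j b) ^ m (j, b))))
      (nullLaw d n) := fun m κ =>
    Integrable.fintype_prod (f := fun j (y : Space d) =>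
      a (κ j) * ((hermiteNorm (κ j)).eval ⟪y, v⟫ * ∏ b, (y b) ^ m (j, b))) fun j => hone _ _
  have e : ∀ y : Fin n → Space d, likelihood a D v y * evalSample f y = ∑ m ∈ f.support,
      f.coeff m * ∑ κ ∈ multiIndices n D,
        ∏ j, (a (κ j) * ((hermiteNorm (κ j)).eval ⟪y j, v⟫ * ∏ b, (y j b) ^ m (j, b))) := by
    intro y
    rw [evalSample_eq_sum, Finset.mul_sum]
    refine Finset.sum_congr rfl fun m _ => ?_
    rw [likelihood, mul_left_comm, Finset.sum_mul]
    congr 1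
    refine Finset.sum_congr rfl fun κ _ => ?_
    rw [← Finset.prod_mul_distrib]
    exact Finset.prod_congr rfl fun j _ => by ring
  simp only [e]
  simp only [evalSample_eq_sum]
  rw [integral_finsetSum _ fun m _ => (hint1 m).const_mul _, integral_finsetSum _ fun m _ =>
    (integrable_finsetSum _ fun κ _ => hint2 m κ).const_mul _]
  refine Finset.sum_congr rfl fun m hm => ?_
  rw [integral_const_mul, integral_const_mul,
    integral_monomial_pi_hiddenLaw_eq (m := fun j b => m (j, b)) hν hv (sum_degree_le hf hm)
      (fun _ => rfl),
    integral_finsetSum _ fun κ _ => hint2 m κ]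

/-- Orthogonality of the Hermite polynomials, for two different directions. -/
theorem integral_likelihood_mul_likelihood {d n D : ℕ} (a : ℕ → ℝ) {v w : Space d} (hv : ‖v‖ = 1)
    (hw : ‖w‖ = 1) :
    ∫ y : Fin n → Space d, likelihood a D v y * likelihood a D w y ∂(nullLaw d n)
      = ∑ κ ∈ multiIndices n D, (∏ j, a (κ j) ^ 2) * ⟪v, w⟫ ^ ∑ j, κ j := by
  have hone : ∀ k l, Integrable (fun y : Space d =>
      (a k * (hermiteNorm k).eval ⟪y, v⟫) * (a l * (hermiteNorm l).eval ⟪y, w⟫))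
      (stdGaussian (Space d)) := fun k l => by
    have h := (((polyGrowth_eval_inner (hermiteNorm k) hv).mul
      (polyGrowth_eval_inner (hermiteNorm l) hw)).integrable_stdGaussian).const_mul (a k * a l)
    refine h.congr (Filter.Eventually.of_forall fun y => ?_)
    simp only
    ring
  have hval : ∀ k l, ∫ y : Space d,
      (a k * (hermiteNorm k).eval ⟪y, v⟫) * (a l * (hermiteNorm l).eval ⟪y, w⟫)
      ∂(stdGaussian (Space d)) = if k = l then a k ^ 2 * ⟪v, w⟫ ^ k else 0 := fun k l => by
    simp only [mul_mul_mul_comm (a k)]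
    rw [integral_const_mul, integral_hermiteNorm_inner_mul_hermiteNorm_inner hv hw]
    split_ifs with h
    · subst h; ring
    · ring
  have e : ∀ y : Fin n → Space d, likelihood a D v y * likelihood a D w y
      = ∑ κ ∈ multiIndices n D, ∑ κ' ∈ multiIndices n D,
        ∏ j, ((a (κ j) * (hermiteNorm (κ j)).eval ⟪y j, v⟫)
          * (a (κ' j) * (hermiteNorm (κ' j)).eval ⟪y j, w⟫)) := by
    intro y
    rw [likelihood, likelihood, Finset.sum_mul_sum]
    simp only [← Finset.prod_mul_distrib]
  have hint : ∀ κ κ' : Fin n → ℕ, Integrable (fun y : Fin n → Space d =>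
      ∏ j, ((a (κ j) * (hermiteNorm (κ j)).eval ⟪y j, v⟫)
          * (a (κ' j) * (hermiteNorm (κ' j)).eval ⟪y j, w⟫))) (nullLaw d n) := fun κ κ' =>
    Integrable.fintype_prod (f := fun j (y : Space d) =>
      (a (κ j) * (hermiteNorm (κ j)).eval ⟪y, v⟫)
          * (a (κ' j) * (hermiteNorm (κ' j)).eval ⟪y, w⟫)) fun j => hone _ _
  simp only [e]
  rw [integral_finsetSum _ fun κ _ => integrable_finsetSum _ fun κ' _ => hint κ κ']
  refine Finset.sum_congr rfl fun κ hκ => ?_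
  rw [integral_finsetSum _ fun κ' _ => hint κ κ']
  have h2 : ∀ κ' : Fin n → ℕ, ∫ y : Fin n → Space d,
      ∏ j, ((a (κ j) * (hermiteNorm (κ j)).eval ⟪y j, v⟫)
          * (a (κ' j) * (hermiteNorm (κ' j)).eval ⟪y j, w⟫)) ∂(nullLaw d n)
      = ∏ j, if κ j = κ' j then a (κ j) ^ 2 * ⟪v, w⟫ ^ κ j else 0 := fun κ' => by
    rw [nullLaw, integral_fintype_prod_eq_prod (f := fun j (y : Space d) =>
      (a (κ j) * (hermiteNorm (κ j)).eval ⟪y, v⟫)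
          * (a (κ' j) * (hermiteNorm (κ' j)).eval ⟪y, w⟫))]
    exact Finset.prod_congr rfl fun j _ => hval _ _
  simp only [h2]
  rw [Finset.sum_eq_single κ]
  · simp only [if_true]
    rw [Finset.prod_mul_distrib, Finset.prod_pow_eq_pow_sum]
  · intro κ' _ hne
    obtain ⟨j, hj⟩ := Function.ne_iff.1 hne
    exact Finset.prod_eq_zero (Finset.mem_univ j) (if_neg hj.symm)
  · exact fun h => absurd hκ h

/-- The second moment of the truncated likelihood ratio of the mixture. -/
theorem integral_integral_likelihood_le {d n D : ℕ} (hd : 0 < d) (a : ℕ → ℝ) :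
    ∫ v : UnitSphere d, ∫ w : UnitSphere d, ∫ y : Fin n → Space d,
        likelihood a D v y * likelihood a D w y ∂(nullLaw d n) ∂(uniformSphere d) ∂(uniformSphere d)
      ≤ (∑ k ∈ Finset.range (D + 1), a k ^ 2 * √(D / d : ℝ) ^ k) ^ n := by
  have := isProbabilityMeasure_uniformSphere hd
  have hint : ∀ v : UnitSphere d, ∀ m : ℕ, Integrable (fun w : UnitSphere d =>
      ⟪(v : Space d), (w : Space d)⟫ ^ m) (uniformSphere d) := fun v m => by
    refine (integrable_const (1 : ℝ)).mono' (Continuous.aestronglyMeasurable (by fun_prop))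
      (Filter.Eventually.of_forall fun w => ?_)
    rw [norm_pow]
    refine pow_le_one₀ (norm_nonneg _) ?_
    simpa using norm_inner_le_norm (𝕜 := ℝ) (v : Space d) (w : Space d)
  have h1 : ∀ v w : UnitSphere d, ∫ y : Fin n → Space d,
      likelihood a D v y * likelihood a D w y ∂(nullLaw d n)
      = ∑ κ ∈ multiIndices n D, (∏ j, a (κ j) ^ 2) * ⟪(v : Space d), (w : Space d)⟫ ^ ∑ j, κ j :=
    fun v w => integral_likelihood_mul_likelihood a (by simp) (by simp)
  have h2 : ∀ v : UnitSphere d, ∫ w : UnitSphere d, ∑ κ ∈ multiIndices n D,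
      (∏ j, a (κ j) ^ 2) * ⟪(v : Space d), (w : Space d)⟫ ^ ∑ j, κ j ∂(uniformSphere d)
      ≤ ∑ κ ∈ multiIndices n D, (∏ j, a (κ j) ^ 2) * √(D / d : ℝ) ^ ∑ j, κ j := by
    intro v
    rw [integral_finsetSum _ fun κ _ => (hint v _).const_mul _]
    refine Finset.sum_le_sum fun κ hκ => ?_
    rw [integral_const_mul]
    refine mul_le_mul_of_nonneg_left ?_ (Finset.prod_nonneg fun _ _ => sq_nonneg _)
    simp only [real_inner_comm _ (v : Space d)]
    exact integral_inner_pow_le hd (Finset.mem_filter.1 hκ).2 (by simp)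
  simp only [h1]
  calc _ ≤ ∫ _ : UnitSphere d, ∑ κ ∈ multiIndices n D, (∏ j, a (κ j) ^ 2) *
        √(D / d : ℝ) ^ ∑ j, κ j ∂(uniformSphere d) := by
        refine integral_mono_of_nonneg ?_ (integrable_const _) (Filter.Eventually.of_forall h2)
        refine Filter.Eventually.of_forall fun v => ?_
        simp only [Pi.zero_apply]
        rw [integral_finsetSum _ fun κ _ => (hint v _).const_mul _]
        refine Finset.sum_nonneg fun κ _ => ?_
        rw [integral_const_mul]
        simp only [real_inner_comm _ (v : Space d)]
        exact mul_nonneg (Finset.prod_nonneg fun _ _ => sq_nonneg _) (integral_inner_pow_nonneg _ _)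
    _ = ∑ κ ∈ multiIndices n D, (∏ j, a (κ j) ^ 2) * √(D / d : ℝ) ^ ∑ j, κ j := by simp
    _ ≤ ∑ κ ∈ Fintype.piFinset fun _ : Fin n => Finset.range (D + 1),
          (∏ j, a (κ j) ^ 2) * √(D / d : ℝ) ^ ∑ j, κ j :=
        Finset.sum_le_sum_of_subset_of_nonneg (Finset.filter_subset _ _) fun κ _ _ =>
          mul_nonneg (Finset.prod_nonneg fun _ _ => sq_nonneg _) (by positivity)
    _ = _ := by
        rw [Finset.sum_pow']
        refine Finset.sum_congr rfl fun κ _ => ?_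
        rw [Finset.prod_mul_distrib, Finset.prod_pow_eq_pow_sum]

/-! ### The advantage against a hidden direction -/

/-- The Markov kernel `v ↦ hiddenLaw ν v` on the unit sphere. -/
noncomputable def hiddenKernel (d : ℕ) (ν : Measure ℝ) [SFinite ν] :
    Kernel (UnitSphere d) (Space d) where
  toFun v := hiddenLaw ν (v : Space d)
  measurable' := by
    refine Measure.measurable_of_measurable_coe _ fun s hs => ?_
    have hm : Measurable fun q : UnitSphere d × Space d × ℝ => replaceCoord (q.1 : Space d) q.2 :=
      (continuous_replaceCoord.comp (by fun_prop :
        Continuous fun q : UnitSphere d × Space d × ℝ => ((q.1 : Space d), q.2))).measurable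
    have h := measurable_measure_prodMk_left (ν := (stdGaussian (Space d)).prod ν) (hm hs)
    have e : (fun v : UnitSphere d => hiddenLaw ν (v : Space d) s) = fun v : UnitSphere d =>
        ((stdGaussian (Space d)).prod ν)
          (Prod.mk v ⁻¹' ((fun q : UnitSphere d × Space d × ℝ =>
            replaceCoord (q.1 : Space d) q.2) ⁻¹' s)) := by
      funext v
      rw [hiddenLaw, Measure.map_apply (by fun_prop) hs]
      rfl
    rw [e]
    exact h

instance isMarkovKernel_hiddenKernel (d : ℕ) (ν : Measure ℝ) [IsProbabilityMeasure ν] :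
    IsMarkovKernel (hiddenKernel d ν) :=
  ⟨fun v => isProbabilityMeasure_hiddenLaw ν (v : Space d)⟩

/-- The mixture `(1 - η) ν₁ + η ν₂` of two laws on the line. -/
noncomputable def lineMixture (η : ℝ) (ν₁ ν₂ : Measure ℝ) : Measure ℝ :=
  ENNReal.ofReal (1 - η) • ν₁ + ENNReal.ofReal η • ν₂

theorem contaminated_hiddenLaw {d : ℕ} (η : ℝ) (ν₁ ν₂ : Measure ℝ) [SFinite ν₁] [SFinite ν₂]
    (v : Space d) :
    contaminated η (hiddenLaw ν₁ v) (hiddenLaw ν₂ v) = hiddenLaw (lineMixture η ν₁ ν₂) v := by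
  rw [contaminated, hiddenLaw, hiddenLaw, hiddenLaw, lineMixture, Measure.prod_add,
    Measure.map_add _ _ (by fun_prop), Measure.prod_smul_right, Measure.prod_smul_right,
    Measure.map_smul, Measure.map_smul]

theorem isProbabilityMeasure_lineMixture {η : ℝ} (h0 : 0 ≤ η) (h1 : η ≤ 1) (ν₁ ν₂ : Measure ℝ)
    [IsProbabilityMeasure ν₁] [IsProbabilityMeasure ν₂] :
    IsProbabilityMeasure (lineMixture η ν₁ ν₂) := by
  constructor
  simp only [lineMixture, Measure.add_apply, Measure.smul_apply, measure_univ, smul_eq_mul, mul_one]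
  rw [← ENNReal.ofReal_add (by linarith) h0]
  simp

theorem integrable_lineMixture (η : ℝ) {ν₁ ν₂ : Measure ℝ} {f : ℝ → ℝ}
    (h₁ : Integrable f ν₁) (h₂ : Integrable f ν₂) : Integrable f (lineMixture η ν₁ ν₂) :=
  (h₁.smul_measure (by simp)).add_measure (h₂.smul_measure (by simp))

theorem integral_lineMixture {η : ℝ} (h0 : 0 ≤ η) (h1 : η ≤ 1) {ν₁ ν₂ : Measure ℝ} {f : ℝ → ℝ}
    (h₁ : Integrable f ν₁) (h₂ : Integrable f ν₂) :
    ∫ x, f x ∂(lineMixture η ν₁ ν₂) = (1 - η) * ∫ x, f x ∂ν₁ + η * ∫ x, f x ∂ν₂ := by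
  rw [lineMixture, integral_add_measure (h₁.smul_measure (by simp)) (h₂.smul_measure (by simp)),
    integral_smul_measure, integral_smul_measure, ENNReal.toReal_ofReal (by linarith),
    ENNReal.toReal_ofReal h0, smul_eq_mul, smul_eq_mul]

/-- The low-degree advantage for detecting a hidden direction along which the law is the mixture
`(1 - η) ν₁ + η ν₂`, in terms of the Hermite coefficients of that mixture. -/
theorem advantage_hiddenKernel_le {d n D : ℕ} (hd : 0 < d) {η : ℝ} (h0 : 0 ≤ η) (h1 : η ≤ 1)
    {ν₁ ν₂ : Measure ℝ} [IsProbabilityMeasure ν₁] [IsProbabilityMeasure ν₂]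
    (hν₁ : HasMoments ν₁) (hν₂ : HasMoments ν₂) :
    (∀ f : MvPolynomial (Fin n × Fin d) ℝ, f.totalDegree ≤ D → Integrable (evalSample f)
      (altLaw d n η (hiddenKernel d ν₁) (hiddenKernel d ν₂))) ∧
    advantage D (altLaw d n η (hiddenKernel d ν₁) (hiddenKernel d ν₂)) (nullLaw d n)
      ≤ ((√((∑ k ∈ Finset.range (D + 1), (∫ x, (hermiteNorm k).eval x ∂(lineMixture η ν₁ ν₂)) ^ 2
          * √(D / d : ℝ) ^ k) ^ n) : ℝ) : EReal) := by
  have := isProbabilityMeasure_uniformSphere hd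
  set ν := lineMixture η ν₁ ν₂ with hνdef
  have : IsProbabilityMeasure ν := isProbabilityMeasure_lineMixture h0 h1 ν₁ ν₂
  have hν : HasMoments ν := fun k => integrable_lineMixture η (hν₁ k) (hν₂ k)
  set a : ℕ → ℝ := fun k => ∫ x, (hermiteNorm k).eval x ∂ν with ha
  let κ : Kernel (UnitSphere d) (Fin n → Space d) :=
    ⟨fun v => Measure.pi fun _ => contaminated η (hiddenKernel d ν₁ v) (hiddenKernel d ν₂ v),
      measurable_pi_contaminated d n η _ _⟩
  have hκ : ∀ v : UnitSphere d, κ v = Measure.pi fun _ => hiddenLaw ν (v : Space d) := fun v => by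
    rw [hνdef, ← contaminated_hiddenLaw]
    rfl
  have : IsMarkovKernel κ := ⟨fun v => by rw [hκ]; infer_instance⟩
  have halt : altLaw d n η (hiddenKernel d ν₁) (hiddenKernel d ν₂) = κ ∘ₘ uniformSphere d := rfl
  have hbound : ∀ f : MvPolynomial (Fin n × Fin d) ℝ, ∃ B, ∀ v : UnitSphere d,
      ∫ y, ‖evalSample f y‖ ∂(κ v) ≤ B := by
    intro f
    obtain ⟨-, c, m, hc, hcm⟩ := sampleGrowth_evalSample f
    refine ⟨c * ∏ _j : Fin n, ∫ p, ((1 + 2 * ‖p.1‖) * (1 + |p.2|)) ^ m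
      ∂((stdGaussian (Space d)).prod ν), fun v => ?_⟩
    have hv : ‖(v : Space d)‖ = 1 := by simp
    have hprod : Integrable (fun y : Fin n → Space d => ∏ j, (1 + ‖y j‖) ^ m)
        (Measure.pi fun _ => hiddenLaw ν (v : Space d)) :=
      Integrable.fintype_prod (f := fun _ (y : Space d) => (1 + ‖y‖) ^ m) fun _ =>
        integrable_one_add_norm_pow_hiddenLaw hν hv m
    rw [hκ]
    calc ∫ y, ‖evalSample f y‖ ∂(Measure.pi fun _ => hiddenLaw ν (v : Space d))
        ≤ ∫ y : Fin n → Space d, c * ∏ j, (1 + ‖y j‖) ^ m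
            ∂(Measure.pi fun _ => hiddenLaw ν (v : Space d)) :=
          integral_mono_of_nonneg (Filter.Eventually.of_forall fun y => norm_nonneg _)
            (hprod.const_mul c) (Filter.Eventually.of_forall hcm)
      _ = c * ∏ _j : Fin n, ∫ y, (1 + ‖y‖) ^ m ∂(hiddenLaw ν (v : Space d)) := by
          rw [integral_const_mul,
            integral_fintype_prod_eq_prod (f := fun _ (y : Space d) => (1 + ‖y‖) ^ m)]
      _ ≤ _ := by
          refine mul_le_mul_of_nonneg_left (Finset.prod_le_prod (fun _ _ => integral_nonneg
            fun y => by positivity) fun _ _ => integral_one_add_norm_pow_hiddenLaw_le hν hv m) hc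
  have hint : ∀ f : MvPolynomial (Fin n × Fin d) ℝ, Integrable (evalSample f)
      (κ ∘ₘ uniformSphere d) := by
    intro f
    have hsm := (continuous_evalSample f).stronglyMeasurable
    rw [Measure.integrable_comp_iff hsm.aestronglyMeasurable]
    refine ⟨Filter.Eventually.of_forall fun v => ?_, ?_⟩
    · rw [hκ]
      exact (sampleGrowth_evalSample f).integrable fun m =>
        integrable_one_add_norm_pow_hiddenLaw hν (by simp) m
    · obtain ⟨B, hB⟩ := hbound f
      refine (integrable_const B).mono' (hsm.norm.integral_kernel).aestronglyMeasurable
        (Filter.Eventually.of_forall fun v => ?_)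
      rw [Real.norm_of_nonneg (integral_nonneg fun y => norm_nonneg _)]
      exact hB v
  refine ⟨fun f _ => by rw [halt]; exact hint f, ?_⟩
  rw [advantage]
  refine iSup_le fun f => ?_
  obtain ⟨f, -, hfD⟩ := f
  rw [EReal.coe_le_coe_iff]
  refine div_le_of_le_mul₀ (Real.sqrt_nonneg _) (Real.sqrt_nonneg _) ?_
  rw [← Real.sqrt_mul (pow_nonneg (Finset.sum_nonneg fun _ _ => by positivity) n)]
  refine Real.le_sqrt_of_sq_le ?_
  have hcomp : ∫ y, evalSample f y ∂(κ ∘ₘ uniformSphere d)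
      = ∫ v, ∫ y, evalSample f y ∂(κ v) ∂(uniformSphere d) := by
    have h := hint f
    rw [Measure.comp_eq_comp_const_apply] at h ⊢
    rw [Kernel.integral_comp h, Kernel.const_apply]
  rw [halt, hcomp]
  have hL : ∀ v : UnitSphere d, ∫ y, evalSample f y ∂(κ v)
      = ∫ y, likelihood a D (v : Space d) y * evalSample f y ∂(nullLaw d n) := fun v => by
    rw [hκ]
    exact integral_pi_hiddenLaw_eq hν (by simp) hfD
  simp only [hL]
  obtain ⟨c, hc, hcb⟩ := exists_abs_likelihood_le d n a D
  have hg : ∀ m : ℕ, Integrable (fun y : Space d => (1 + ‖y‖) ^ m) (stdGaussian (Space d)) :=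
    integrable_one_add_norm_pow_stdGaussian d
  have hU : SampleGrowth fun y : Fin n → Space d => c * ∏ j, (1 + ‖y j‖) ^ D :=
    ⟨by fun_prop, c, D, hc, fun y => by
      rw [abs_of_nonneg (mul_nonneg hc (Finset.prod_nonneg fun _ _ => by positivity))]⟩
  have hf2 := (sampleGrowth_evalSample f).mul (sampleGrowth_evalSample f)
  have hCS := sq_integral_integral_mul_le (μ := uniformSphere d) (ν := nullLaw d n)
    (L := fun (v : UnitSphere d) y => likelihood a D (v : Space d) y)
    (U := fun y : Fin n → Space d => c * ∏ j, (1 + ‖y j‖) ^ D) (f := evalSample f)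
    ((continuous_likelihood a D).comp (by fun_prop : Continuous
      fun p : UnitSphere d × (Fin n → Space d) => ((p.1 : Space d), p.2))).measurable
    hU.1.measurable (fun v y => hcb v (by simp) y)
    (by simpa only [pow_two, nullLaw] using (hU.mul hU).integrable hg)
    (continuous_evalSample f).aestronglyMeasurable
    (by simpa only [pow_two, nullLaw] using hf2.integrable hg)
  refine hCS.trans (mul_le_mul_of_nonneg_right (integral_integral_likelihood_le hd a)
    (integral_nonneg fun y => sq_nonneg _))

/-! ### Matching the Gaussian moments -/

theorem eq_zero_of_ae_eval_eq_zero {P : Polynomial ℝ}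
    (h : ∀ᵐ x ∂((gaussianReal 0 1).restrict (Set.Icc (-1) 1)), P.eval x = 0) : P = 0 := by
  by_contra hP
  have := nullSingletonClass_gaussianReal (μ := 0) (v := 1) one_ne_zero
  have hfin : {x : ℝ | P.eval x = 0}.Finite := by
    refine (P.roots.toFinset.finite_toSet).subset fun x hx => ?_
    simpa [hP] using hx
  have h0 : ∀ᵐ x ∂((gaussianReal 0 1).restrict (Set.Icc (-1) 1)), ¬ P.eval x = 0 := by
    refine ae_restrict_of_ae ?_
    rw [ae_iff]
    simpa using hfin.measure_zero (gaussianReal 0 1)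
  have hne : ∀ᵐ x ∂((gaussianReal 0 1).restrict (Set.Icc (-1) 1)), False := by
    filter_upwards [h, h0] with x hx hx' using hx' hx
  rw [ae_iff] at hne
  simp only [not_false_eq_true, Set.ofPred_true, Measure.restrict_apply_univ] at hne
  have := gaussianReal_absolutelyContinuous' 0 one_ne_zero hne
  rw [Real.volume_Icc, ENNReal.ofReal_eq_zero] at this
  norm_num at this

/-- The functionals `f ↦ E[f(x) x ^ k]`, `k < N`, on bounded functions of a standard Gaussian are
linearly independent: they have a dual family, made of polynomials cut off outside `[-1, 1]`. -/
theorem exists_bounded_dual (N : ℕ) : ∃ (g : Fin N → ℝ → ℝ) (G : ℝ), 0 ≤ G ∧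
    (∀ j, Measurable (g j)) ∧ (∀ j x, |g j x| ≤ G) ∧
    ∀ j k : Fin N, ∫ x, g j x * x ^ (k : ℕ) ∂(gaussianReal 0 1) = if j = k then 1 else 0 := by
  set μ := (gaussianReal 0 1).restrict (Set.Icc (-1) 1)
  have hμ : ∀ P : Polynomial ℝ, Integrable (fun x => P.eval x) μ := fun P =>
    (hasMoments_gaussianReal.integrable_eval P).restrict
  let p : (Fin N → ℝ) → Polynomial ℝ := fun c => ∑ j, Polynomial.C (c j) * Polynomial.X ^ (j : ℕ)
  let M : Matrix (Fin N) (Fin N) ℝ := Matrix.of fun k j => ∫ x, x ^ (j : ℕ) * x ^ (k : ℕ) ∂μ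
  have hM : ∀ c k, M.mulVec c k = ∫ x, (p c).eval x * x ^ (k : ℕ) ∂μ := by
    intro c k
    have e : ∀ x : ℝ, (p c).eval x * x ^ (k : ℕ)
        = ∑ j : Fin N, c j * (x ^ (j : ℕ) * x ^ (k : ℕ)) := by
      intro x
      simp [p, Polynomial.eval_finsetSum, Finset.sum_mul, mul_assoc]
    simp only [e]
    rw [integral_finsetSum]
    · simp only [integral_const_mul, Matrix.mulVec, dotProduct, M, Matrix.of_apply]
      exact Finset.sum_congr rfl fun j _ => mul_comm _ _
    · intro j _
      have := hμ (Polynomial.X ^ (j : ℕ) * Polynomial.X ^ (k : ℕ))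
      simp only [Polynomial.eval_mul, Polynomial.eval_pow, Polynomial.eval_X] at this
      exact this.const_mul _
  -- `M` is the Gram matrix of the monomials on `[-1, 1]`, hence injective
  have hinj : Function.Injective (Matrix.mulVecLin M) := by
    rw [injective_iff_map_eq_zero]
    intro c hc
    have h1 : ∫ x, (p c).eval x * (p c).eval x ∂μ = 0 := by
      have e : ∀ x : ℝ, (p c).eval x * (p c).eval x
          = ∑ k : Fin N, c k * ((p c).eval x * x ^ (k : ℕ)) := by
        intro x
        have : (p c).eval x = ∑ k : Fin N, c k * x ^ (k : ℕ) := by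
          simp [p, Polynomial.eval_finsetSum]
        conv_lhs => rw [mul_comm]; enter [1]; rw [this]
        rw [Finset.sum_mul]
        exact Finset.sum_congr rfl fun k _ => by ring
      simp only [e]
      rw [integral_finsetSum]
      · refine Finset.sum_eq_zero fun k _ => ?_
        rw [integral_const_mul, ← hM]
        have := congrFun hc k
        rw [Matrix.mulVecLin_apply] at this
        rw [this]
        simp
      · intro k _
        have := hμ (p c * Polynomial.X ^ (k : ℕ))
        simp only [Polynomial.eval_mul, Polynomial.eval_pow, Polynomial.eval_X] at this
        exact this.const_mul _
    have h2 := hμ (p c * p c)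
    simp only [Polynomial.eval_mul] at h2
    rw [integral_eq_zero_iff_of_nonneg (fun x => mul_self_nonneg _) h2] at h1
    have h3 : p c = 0 := eq_zero_of_ae_eval_eq_zero (by
      filter_upwards [h1] with x hx
      simpa using hx)
    funext k
    have h4 := congrArg (fun P => P.coeff (k : ℕ)) h3
    simpa [p, Polynomial.finsetSum_coeff, Polynomial.coeff_X_pow, Fin.val_inj] using h4
  have hsurj := LinearMap.injective_iff_surjective.1 hinj
  choose c hc using fun j : Fin N => hsurj (Pi.single j 1)
  let B : Fin N → ℝ := fun j => (∑ k ∈ Finset.range ((p (c j)).natDegree + 1), |(p (c j)).coeff k|)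
    * 2 ^ (p (c j)).natDegree
  have hB : ∀ j, 0 ≤ B j := fun j =>
    mul_nonneg (Finset.sum_nonneg fun _ _ => abs_nonneg _) (by positivity)
  refine ⟨fun j => (Set.Icc (-1) 1).indicator fun x => (p (c j)).eval x, ∑ j, B j,
    Finset.sum_nonneg fun j _ => hB j, fun j => ?_, fun j x => ?_, fun j k => ?_⟩
  · exact (p (c j)).continuous.measurable.indicator measurableSet_Icc
  · refine le_trans ?_ (Finset.single_le_sum (fun j _ => hB j) (Finset.mem_univ j))
    simp only
    by_cases hx : x ∈ Set.Icc (-1 : ℝ) 1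
    · rw [Set.indicator_of_mem hx]
      refine (abs_eval_le _ x).trans ?_
      have : |x| ≤ 1 := abs_le.2 hx
      refine mul_le_mul_of_nonneg_left ?_ (Finset.sum_nonneg fun _ _ => abs_nonneg _)
      exact pow_le_pow_left₀ (by positivity) (by linarith) _
    · rw [Set.indicator_of_notMem hx, abs_zero]
      exact hB j
  · have h1 := congrFun (hc j) k
    rw [Matrix.mulVecLin_apply, hM] at h1
    have e : ∀ x : ℝ, (Set.Icc (-1) 1).indicator (fun x => (p (c j)).eval x) x * x ^ (k : ℕ)
        = (Set.Icc (-1) 1).indicator (fun x => (p (c j)).eval x * x ^ (k : ℕ)) x := by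
      intro x
      by_cases hx : x ∈ Set.Icc (-1 : ℝ) 1 <;> simp [hx]
    simp only [e]
    rw [integral_indicator measurableSet_Icc, h1, Pi.single_apply]
    simp only [eq_comm]

/-- The measure with density `1 + q` with respect to the standard Gaussian on the line. -/
noncomputable def tilted (q : ℝ → ℝ) : Measure ℝ :=
  (gaussianReal 0 1).withDensity fun x => ENNReal.ofReal (1 + q x)

theorem tilted_le {q : ℝ → ℝ} (hq : ∀ x, |q x| ≤ 1 / 2) :
    tilted q ≤ (2 : ℝ≥0∞) • gaussianReal 0 1 := by
  rw [tilted, ← withDensity_const]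
  refine withDensity_mono (Filter.Eventually.of_forall fun x => ?_)
  rw [← ENNReal.ofReal_ofNat]
  exact ENNReal.ofReal_le_ofReal (by linarith [(abs_le.1 (hq x)).2])

theorem integral_tilted {q : ℝ → ℝ} (hqm : Measurable q) (hq : ∀ x, |q x| ≤ 1 / 2) {F : ℝ → ℝ}
    (hF : Integrable F (gaussianReal 0 1)) :
    ∫ x, F x ∂(tilted q) = ∫ x, F x ∂(gaussianReal 0 1) + ∫ x, q x * F x ∂(gaussianReal 0 1) := by
  rw [tilted, integral_withDensity_eq_integral_toReal_smul (by fun_prop)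
    (Filter.Eventually.of_forall fun x => ENNReal.ofReal_lt_top), ← integral_add hF
    (hF.bdd_mul hqm.aestronglyMeasurable (Filter.Eventually.of_forall fun x => hq x))]
  refine integral_congr_ae (Filter.Eventually.of_forall fun x => ?_)
  simp only [smul_eq_mul]
  rw [ENNReal.toReal_ofReal (by linarith [(abs_le.1 (hq x)).1])]
  ring

theorem hasMoments_of_le {ν : Measure ℝ} (hν : ν ≤ (2 : ℝ≥0∞) • gaussianReal 0 1) :
    HasMoments ν := fun k =>
  ((hasMoments_gaussianReal k).smul_measure (by simp)).mono_measure hν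

theorem hasMoments_dirac (t : ℝ) : HasMoments (Measure.dirac t) := fun k =>
  integrable_dirac (by simp)

theorem abs_integral_mul_hermiteNorm_le {q : ℝ → ℝ} {ε : ℝ} (hq : ∀ x, |q x| ≤ ε) (k : ℕ) :
    |∫ x, q x * (hermiteNorm k).eval x ∂(gaussianReal 0 1)| ≤ ε := by
  have h1 := hasMoments_gaussianReal.integrable_eval (hermiteNorm k)
  have h2 := hasMoments_gaussianReal.integrable_eval (hermiteNorm k * hermiteNorm k)
  simp only [Polynomial.eval_mul] at h2
  have hε : 0 ≤ ε := (abs_nonneg _).trans (hq 0)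
  have hb : ∀ x, ‖q x * (hermiteNorm k).eval x‖
      ≤ ε * ((1 + (hermiteNorm k).eval x * (hermiteNorm k).eval x) / 2) := by
    intro x
    rw [norm_mul, Real.norm_eq_abs, Real.norm_eq_abs]
    refine mul_le_mul (hq x) ?_ (abs_nonneg _) hε
    have := sq_nonneg (|(hermiteNorm k).eval x| - 1)
    have h3 := abs_mul_abs_self ((hermiteNorm k).eval x)
    nlinarith
  have h3 := norm_integral_le_of_norm_le
    ((((integrable_const (1 : ℝ)).add h2).div_const 2).const_mul ε)
    (Filter.Eventually.of_forall hb)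
  refine h3.trans ?_
  simp only [Pi.add_apply]
  rw [integral_const_mul, integral_div, integral_add (integrable_const _) h2,
    integral_hermiteNorm_mul_self]
  simp

/-- The symmetric two-point law at `± t`. -/
noncomputable def twoPoint (t : ℝ) : Measure ℝ :=
  lineMixture (1 / 2) (Measure.dirac t) (Measure.dirac (-t))

instance isProbabilityMeasure_twoPoint (t : ℝ) : IsProbabilityMeasure (twoPoint t) :=
  isProbabilityMeasure_lineMixture (by norm_num) (by norm_num) _ _

theorem hasMoments_twoPoint (t : ℝ) : HasMoments (twoPoint t) := fun k =>
  integrable_lineMixture _ (hasMoments_dirac t k) (hasMoments_dirac (-t) k)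

theorem integral_twoPoint (t : ℝ) (P : Polynomial ℝ) :
    ∫ x, P.eval x ∂(twoPoint t) = (P.eval t + P.eval (-t)) / 2 := by
  rw [twoPoint, integral_lineMixture (by norm_num) (by norm_num)
    ((hasMoments_dirac t).integrable_eval P) ((hasMoments_dirac (-t)).integrable_eval P),
    integral_dirac, integral_dirac]
  ring

/-- The inliers `ν₁` and outliers `ν₂` along the hidden direction. The outliers sit at `± t`, the
inliers are a bounded perturbation of the Gaussian that compensates their moments up to order
`i + 1` in the mixture. -/
theorem exists_moment_matching {i : ℕ} (hi : Even i) (hi0 : 0 < i) : ∃ K : ℝ, 1 ≤ K ∧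
    ∀ η t : ℝ, 0 < η → η ≤ 1 / 2 → 1 ≤ t → K * (η * t ^ i) ≤ 1 / 2 →
    ∃ ν₁ ν₂ : Measure ℝ, IsProbabilityMeasure ν₁ ∧ IsProbabilityMeasure ν₂ ∧
      HasMoments ν₂ ∧ ν₁ ≤ (2 : ℝ≥0∞) • gaussianReal 0 1 ∧
      ∫ x, x ∂ν₁ = 0 ∧ ∫ x, x ^ 2 ∂ν₁ = 1 - η / (1 - η) * (t ^ 2 - 1) ∧
      (∀ k, 1 ≤ k → k < i + 2 → ∫ x, (hermiteNorm k).eval x ∂(lineMixture η ν₁ ν₂) = 0) ∧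
      ∀ k, i + 2 ≤ k → (∫ x, (hermiteNorm k).eval x ∂(lineMixture η ν₁ ν₂)) ^ 2
        ≤ (K + 1) ^ 2 * η ^ 2 * (k.factorial * (t ^ 2) ^ k) := by
  obtain ⟨g, G, hG, hgm, hgb, hgd⟩ := exists_bounded_dual (i + 2)
  set m : ℕ → ℝ := fun k => ∫ x, x ^ k ∂(gaussianReal 0 1) with hm
  set S : ℝ := ∑ k ∈ Finset.range (i + 2), |m k|
  have hS : 0 ≤ S := Finset.sum_nonneg fun _ _ => abs_nonneg _
  refine ⟨1 + (i + 2) * (2 * (S + 1) * G), by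
    have : 0 ≤ ((i : ℝ) + 2) * (2 * (S + 1) * G) := by positivity
    linarith, ?_⟩
  set K : ℝ := 1 + (i + 2) * (2 * (S + 1) * G)
  have hK : 0 ≤ K := by positivity
  intro η t hη hη2 ht hKt
  set e : ℕ → ℝ := fun k => ∫ x, x ^ k ∂(twoPoint t) with he
  have heq : ∀ k, e k = (t ^ k + (-t) ^ k) / 2 := fun k => by
    have := integral_twoPoint t (Polynomial.X ^ k)
    simpa using this
  have hti : (1 : ℝ) ≤ t ^ i := one_le_pow₀ ht
  have heb : ∀ k, k < i + 2 → |e k| ≤ t ^ i := by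
    intro k hk
    rw [heq]
    rcases Nat.even_or_odd k with hev | hodd
    · have hki : k ≤ i := by
        rcases hi with ⟨a, ha⟩
        rcases hev with ⟨b, hb⟩
        omega
      rw [hev.neg_pow]
      have : t ^ k ≤ t ^ i := pow_le_pow_right₀ ht hki
      rw [abs_of_nonneg (by positivity)]
      linarith
    · -- here `k = i + 1` is possible, but the odd moments of the outliers vanish
      rw [hodd.neg_pow]
      simp
      linarith
  -- the moments of `q` that compensate those of the outliers
  set τ : ℕ → ℝ := fun k => η / (1 - η) * (m k - e k) with hτ
  have hη1 : 0 < 1 - η := by linarith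
  have hτb : ∀ k, k < i + 2 → |τ k| ≤ 2 * (S + 1) * (η * t ^ i) := by
    intro k hk
    rw [hτ]
    simp only
    rw [abs_mul, abs_of_nonneg (by positivity)]
    have h1 : η / (1 - η) ≤ 2 * η := by
      rw [div_le_iff₀ hη1]
      nlinarith
    have h2 : |m k| ≤ S :=
      Finset.single_le_sum (f := fun k => |m k|) (fun _ _ => abs_nonneg _) (Finset.mem_range.2 hk)
    have h3 : |m k - e k| ≤ (S + 1) * t ^ i := by
      refine (abs_sub _ _).trans ?_
      have := heb k hk
      nlinarith
    calc η / (1 - η) * |m k - e k| ≤ (2 * η) * ((S + 1) * t ^ i) := by gcongr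
      _ = _ := by ring
  set q : ℝ → ℝ := fun x => ∑ j : Fin (i + 2), τ j * g j x with hq
  have hqm : Measurable q := by
    refine Finset.measurable_sum _ fun j _ => (hgm j).const_mul _
  have hqb : ∀ x, |q x| ≤ K * (η * t ^ i) := by
    intro x
    calc |q x| ≤ ∑ j : Fin (i + 2), |τ j * g j x| := Finset.abs_sum_le_sum_abs _ _
      _ ≤ ∑ j : Fin (i + 2), 2 * (S + 1) * (η * t ^ i) * G := by
          refine Finset.sum_le_sum fun j _ => ?_
          rw [abs_mul]
          have := hτb j j.2
          have := hgb j x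
          gcongr
      _ = (i + 2) * (2 * (S + 1) * G) * (η * t ^ i) := by
          simp
          ring
      _ ≤ _ := by
          refine mul_le_mul_of_nonneg_right ?_ (by positivity)
          simp only [K]
          linarith
  have hqh : ∀ x, |q x| ≤ 1 / 2 := fun x => (hqb x).trans hKt
  have hqk : ∀ k, k < i + 2 → ∫ x, q x * x ^ k ∂(gaussianReal 0 1) = τ k := by
    intro k hk
    have e1 : ∀ x, q x * x ^ k = ∑ j : Fin (i + 2), τ j * (g j x * x ^ k) := by
      intro x
      rw [hq]
      simp only
      rw [Finset.sum_mul]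
      exact Finset.sum_congr rfl fun j _ => by ring
    simp only [e1]
    rw [integral_finsetSum]
    · simp only [integral_const_mul]
      have h1 := fun j => hgd j ⟨k, hk⟩
      simp only [h1]
      simp
    · intro j _
      exact ((hasMoments_gaussianReal k).bdd_mul (hgm j).aestronglyMeasurable
        (Filter.Eventually.of_forall fun x => hgb j x)).const_mul _
  have hle := tilted_le hqh
  have hν₁ := hasMoments_of_le hle
  have hmk : ∀ k, k < i + 2 → ∫ x, x ^ k ∂(tilted q) = m k + τ k := fun k hk => by
    rw [integral_tilted hqm hqh (hasMoments_gaussianReal k), hqk k hk]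
  have hm0 : m 0 = 1 := by simp [hm]
  have hm1 : m 1 = 0 := by simp [hm, integral_id_gaussianReal]
  have hm2 : m 2 = 1 := by
    have := integral_X_mul_gaussianReal Polynomial.X
    simpa [hm, pow_two] using this
  have hfin : IsFiniteMeasure (tilted q) := 
    ⟨(hle Set.univ).trans_lt (by simp)⟩
  have hprob : IsProbabilityMeasure (tilted q) := by
    have h := hmk 0 (by omega)
    rw [hτ] at h
    simp only [hm0, heq, pow_zero, integral_const, smul_eq_mul, mul_one] at h
    norm_num at h
    refine ⟨?_⟩
    rw [← ENNReal.toReal_eq_one_iff]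
    exact h
  have hmix : ∀ k, ∫ x, (hermiteNorm k).eval x ∂(lineMixture η (tilted q) (twoPoint t))
      = (1 - η) * ∫ x, (hermiteNorm k).eval x ∂(tilted q)
        + η * ∫ x, (hermiteNorm k).eval x ∂(twoPoint t) := fun k =>
    integral_lineMixture hη.le (by linarith) (hν₁.integrable_eval _)
      ((hasMoments_twoPoint t).integrable_eval _)
  have hg0 : ∀ k, 1 ≤ k → ∫ x, (hermiteNorm k).eval x ∂(gaussianReal 0 1) = 0 := fun k hk => by
    have := integral_hermiteNorm_mul_of_lt (k := k) (P := 1) (by simp; omega)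
    simpa using this
  refine ⟨tilted q, twoPoint t, hprob, inferInstance, hasMoments_twoPoint t, hle, ?_, ?_,
    fun k hk1 hk2 => ?_, fun k hk => ?_⟩
  · have h := hmk 1 (by omega)
    rw [hτ] at h
    simp only [hm1, heq, pow_one] at h
    rw [h]
    ring
  · have h := hmk 2 (by omega)
    rw [hτ] at h
    simp only [hm2, heq] at h
    rw [h]
    ring
  · rw [← hg0 k hk1]
    have hmom : ∀ l, l < i + 2 → ∫ x, x ^ l ∂(lineMixture η (tilted q) (twoPoint t)) = m l := by
      intro l hl
      rw [integral_lineMixture hη.le (by linarith) (hν₁ l) (hasMoments_twoPoint t l), hmk l hl,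
        hτ]
      simp only
      change (1 - η) * (m l + η / (1 - η) * (m l - e l)) + η * e l = m l
      field_simp
      ring
    have hmixm : HasMoments (lineMixture η (tilted q) (twoPoint t)) := fun l =>
      integrable_lineMixture η (hν₁ l) (hasMoments_twoPoint t l)
    simp only [Polynomial.eval_eq_sum_range]
    rw [integral_finsetSum _ fun l _ => (hmixm l).const_mul _,
      integral_finsetSum _ fun l _ => (hasMoments_gaussianReal l).const_mul _]
    refine Finset.sum_congr rfl fun l hl => ?_
    rw [natDegree_hermiteNorm, Finset.mem_range] at hl
    rw [integral_const_mul, integral_const_mul, hmom l (by omega)]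
  · rw [hmix, integral_tilted hqm hqh (hasMoments_gaussianReal.integrable_eval _),
      hg0 k (by omega), zero_add, integral_twoPoint]
    set A := ∫ x, q x * (hermiteNorm k).eval x ∂(gaussianReal 0 1)
    have hA : |A| ≤ K * (η * t ^ i) := abs_integral_mul_hermiteNorm_le hqb k
    set w : ℝ := √(k.factorial * (t ^ 2) ^ k)
    have hh : ∀ s : ℝ, |s| = t → |(hermiteNorm k).eval s| ≤ w := fun s hs => by
      refine Real.abs_le_sqrt ?_
      have := sq_eval_hermiteNorm_le k (t := s) (by rw [hs]; exact ht)
      rwa [← sq_abs s, hs] at this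
    have h1 := hh t (abs_of_pos (by linarith))
    have h2 := hh (-t) (by rw [abs_neg]; exact abs_of_pos (by linarith))
    have hw : t ^ i ≤ w := by
      refine Real.le_sqrt_of_sq_le ?_
      rw [← pow_mul, mul_comm, pow_mul]
      have h3 : (t ^ 2) ^ i ≤ (t ^ 2) ^ k := pow_le_pow_right₀ (one_le_pow₀ ht) (by omega)
      have h4 : (1 : ℝ) ≤ k.factorial := by exact_mod_cast k.factorial_pos
      have h5 : (0 : ℝ) ≤ (t ^ 2) ^ k := by positivity
      nlinarith
    have hw2 : w ^ 2 = k.factorial * (t ^ 2) ^ k := Real.sq_sqrt (by positivity)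
    have hB : |(1 - η) * A + η * (((hermiteNorm k).eval t + (hermiteNorm k).eval (-t)) / 2)|
        ≤ (K + 1) * η * w := by
      have hw0 : 0 ≤ w := Real.sqrt_nonneg _
      have h3 : |(1 - η) * A| ≤ K * η * w := by
        rw [abs_mul, abs_of_pos hη1]
        calc (1 - η) * |A| ≤ 1 * (K * (η * w)) := by
              have : K * (η * t ^ i) ≤ K * (η * w) := by gcongr
              exact mul_le_mul (by linarith) (hA.trans this) (abs_nonneg _) zero_le_one
          _ = _ := by ring
      have h4 : |η * (((hermiteNorm k).eval t + (hermiteNorm k).eval (-t)) / 2)| ≤ η * w := by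
        rw [abs_mul, abs_of_pos hη]
        refine mul_le_mul_of_nonneg_left ?_ hη.le
        rw [abs_div, abs_two]
        have := abs_add_le ((hermiteNorm k).eval t) ((hermiteNorm k).eval (-t))
        linarith
      refine (abs_add_le _ _).trans ?_
      linarith
    rw [← sq_abs, ← hw2]
    calc _ ≤ ((K + 1) * η * w) ^ 2 := pow_le_pow_left₀ (abs_nonneg _) hB 2
      _ = _ := by ring

/-! ### The inliers are admissible -/

theorem hiddenLaw_le {d : ℕ} {ν : Measure ℝ} [SFinite ν]
    (hν : ν ≤ (2 : ℝ≥0∞) • gaussianReal 0 1) {v : Space d} (hv : ‖v‖ = 1) :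
    hiddenLaw ν v ≤ (2 : ℝ≥0∞) • stdGaussian (Space d) := by
  calc hiddenLaw ν v ≤ hiddenLaw ((2 : ℝ≥0∞) • gaussianReal 0 1) v :=
        Measure.map_mono (Measure.prod_mono le_rfl hν) (by fun_prop)
    _ = (2 : ℝ≥0∞) • hiddenLaw (gaussianReal 0 1) v := by
        rw [hiddenLaw, hiddenLaw, Measure.prod_smul_right, Measure.map_smul]
    _ = _ := by rw [hiddenLaw_gaussianReal hv]

theorem integral_abs_pow_gaussianReal_le (k : ℕ) :
    ∫ x, |x| ^ k ∂(gaussianReal 0 1) ≤ √(2 * k : ℝ) ^ k := by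
  have h1 := hasMoments_gaussianReal.integrable_abs_pow k
  have h2 : Integrable (fun x : ℝ => (|x| ^ k) ^ 2) (gaussianReal 0 1) := by
    have := hasMoments_gaussianReal.integrable_abs_pow (2 * k)
    simpa only [← pow_mul, mul_comm k 2] using this
  have h := sq_integral_mul_le (ν := gaussianReal 0 1) (f := fun x => |x| ^ k) (g := fun _ => 1)
    h2 (by simp) (by simpa using h1)
  simp only [mul_one, one_pow, integral_const, probReal_univ, one_smul] at h
  have e : ∀ x : ℝ, (|x| ^ k) ^ 2 = x ^ (2 * k) := fun x => by
    rw [← pow_mul, mul_comm, (even_two_mul k).pow_abs]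
  simp only [e] at h
  have h3 : (∫ x, |x| ^ k ∂(gaussianReal 0 1)) ^ 2 ≤ (√(2 * k : ℝ) ^ k) ^ 2 := by
    rw [← pow_mul, mul_comm k 2, pow_mul, Real.sq_sqrt (by positivity)]
    exact h.trans (integral_even_pow_gaussianReal_le k)
  exact le_of_sq_le_sq h3 (by positivity)

theorem integral_inner_hiddenLaw {d : ℕ} {ν : Measure ℝ} [IsProbabilityMeasure ν]
    (hν : HasMoments ν) (hmean : ∫ x, x ∂ν = 0) (v u : Space d) :
    ∫ x, ⟪x, u⟫ ∂(hiddenLaw ν v) = 0 := by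
  have hi : ∀ w : Space d, Integrable (fun z : Space d => ⟪z, w⟫) (stdGaussian (Space d)) ∧
      ∫ z, ⟪z, w⟫ ∂(stdGaussian (Space d)) = 0 := by
    intro w
    have hid : Integrable (fun z : Space d => z) (stdGaussian (Space d)) := IsGaussian.integrable_id
    simp only [real_inner_comm w]
    refine ⟨hid.const_inner w, ?_⟩
    rw [integral_inner hid, integral_id_stdGaussian, inner_zero_right]
  have h1 : Integrable (fun t : ℝ => t) ν := by simpa using hν 1
  rw [integral_hiddenLaw _ _ (by fun_prop)]
  have e : ∀ p : Space d × ℝ, ⟪replaceCoord v p, u⟫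
      = ⟪v, u⟫ * p.2 + (⟪p.1, u⟫ - ⟪p.1, v⟫ * ⟪v, u⟫) := fun p => inner_replaceCoord v u p.1 p.2
  simp only [e]
  rw [integral_add, integral_const_mul, integral_sub]
  · rw [integral_mul_const, integral_fun_fst (fun z : Space d => ⟪z, u⟫),
      integral_fun_fst (fun z : Space d => ⟪z, v⟫), integral_fun_snd (fun t : ℝ => t), hmean,
      (hi u).2, (hi v).2]
    simp
  · exact (hi u).1.comp_fst ν
  · exact ((hi v).1.comp_fst ν).mul_const _
  · exact (h1.comp_snd _).const_mul _
  · exact ((hi u).1.comp_fst ν).sub (((hi v).1.comp_fst ν).mul_const _)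

theorem integral_id_hiddenLaw {d : ℕ} {ν : Measure ℝ} [IsProbabilityMeasure ν]
    (hν : HasMoments ν) (hmean : ∫ x, x ∂ν = 0) {v : Space d} (hv : ‖v‖ = 1) :
    ∫ x, x ∂(hiddenLaw ν v) = 0 := by
  have hid : Integrable (fun x : Space d => x) (hiddenLaw ν v) := by
    refine (integrable_one_add_norm_pow_hiddenLaw hν hv 1).mono' (by fun_prop)
      (Filter.Eventually.of_forall fun x => ?_)
    simp
  refine ext_inner_left ℝ fun u => ?_
  rw [← integral_inner hid, inner_zero_right]
  simp only [real_inner_comm _ u]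
  exact integral_inner_hiddenLaw hν hmean v u

theorem isSubgaussian_hiddenLaw {d : ℕ} {ν : Measure ℝ} [IsProbabilityMeasure ν]
    (hle : ν ≤ (2 : ℝ≥0∞) • gaussianReal 0 1) (hmean : ∫ x, x ∂ν = 0) {v : Space d}
    (hv : ‖v‖ = 1) : IsSubgaussian 4 (hiddenLaw ν v) := by
  have hν := hasMoments_of_le hle
  intro k u hu
  rw [integral_id_hiddenLaw hν hmean hv]
  simp only [sub_zero]
  have hint : Integrable (fun x : Space d => ⟪x, u⟫ ^ k) (hiddenLaw ν v) := by
    have := (polyGrowth_eval_inner (Polynomial.X ^ k) hu).integrable_hiddenLaw hν hv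
    simpa using this
  refine ⟨hint, ?_⟩
  rcases Nat.eq_zero_or_pos k with rfl | hk
  · simp
  have hG : Integrable (fun x : Space d => |⟪x, u⟫| ^ k) (stdGaussian (Space d)) := by
    have := (polyGrowth_eval_inner (Polynomial.X ^ k) hu).integrable_stdGaussian.abs
    simpa [abs_pow] using this
  have habs : ∫ x : Space d, |⟪x, u⟫| ^ k ∂(stdGaussian (Space d))
      = ∫ x, |x| ^ k ∂(gaussianReal 0 1) := by
    rw [← map_inner_stdGaussian hu, integral_map (by fun_prop)
      (Measurable.aestronglyMeasurable (by fun_prop))]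
  have hs : √(2 * k : ℝ) ≤ 2 * √(k : ℝ) := by
    rw [Real.sqrt_mul (by norm_num)]
    have : √(2 : ℝ) ≤ 2 := by
      rw [Real.sqrt_le_left (by norm_num)]
      norm_num
    gcongr
  calc ∫ x : Space d, ⟪x, u⟫ ^ k ∂(hiddenLaw ν v)
      ≤ ∫ x : Space d, |⟪x, u⟫| ^ k ∂(hiddenLaw ν v) := by
        refine integral_mono hint (by simpa [abs_pow] using hint.abs) fun x => ?_
        simp only [← abs_pow]
        exact le_abs_self _
    _ ≤ ∫ x : Space d, |⟪x, u⟫| ^ k ∂((2 : ℝ≥0∞) • stdGaussian (Space d)) :=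
        integral_mono_measure (hiddenLaw_le hle hv)
          (Filter.Eventually.of_forall fun x => by positivity) (hG.smul_measure (by simp))
    _ = 2 * ∫ x, |x| ^ k ∂(gaussianReal 0 1) := by
        rw [integral_smul_measure, habs]
        simp
    _ ≤ 2 * (2 * √(k : ℝ)) ^ k := by
        have := integral_abs_pow_gaussianReal_le k
        have h2 : √(2 * k : ℝ) ^ k ≤ (2 * √(k : ℝ)) ^ k := by gcongr
        linarith
    _ ≤ 2 ^ k * (2 * √(k : ℝ)) ^ k := by
        refine mul_le_mul_of_nonneg_right ?_ (by positivity)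
        exact le_self_pow₀ (by norm_num) hk.ne'
    _ = (4 * √(k : ℝ)) ^ k := by
        rw [← mul_pow]
        ring

/-- The covariance matrix is tested on the hidden direction `v` itself. -/
theorem le_norm_covMatrix_hiddenLaw {d : ℕ} {ν : Measure ℝ} [IsProbabilityMeasure ν]
    (hν : HasMoments ν) (hmean : ∫ x, x ∂ν = 0) {v : Space d} (hv : ‖v‖ = 1) :
    |∫ x, x ^ 2 ∂ν - 1|
      ≤ ‖Matrix.toEuclideanCLM (n := Fin d) (𝕜 := ℝ) (covMatrix (hiddenLaw ν v) - 1)‖ := by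
  have hcoord : ∀ a : Fin d, ∫ x : Space d, x a ∂(hiddenLaw ν v) = 0 := fun a => by
    have := integral_inner_hiddenLaw hν hmean v (EuclideanSpace.single a (1 : ℝ))
    simpa [EuclideanSpace.inner_single_right] using this
  have hcov : ∀ a b, covMatrix (hiddenLaw ν v) a b = ∫ x : Space d, x a * x b ∂(hiddenLaw ν v) :=
    fun a b => by simp [covMatrix, covariance, hcoord]
  have hint : ∀ a b : Fin d, Integrable (fun x : Space d => x a * x b) (hiddenLaw ν v) :=
    fun a b => by
      have h : ∀ a : Fin d, PolyGrowth fun x : Space d => x a := fun a => by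
        refine ⟨by fun_prop, 1, 1, fun x => ?_⟩
        have := PiLp.norm_apply_le x a
        rw [Real.norm_eq_abs] at this
        linarith
      exact ((h a).mul (h b)).integrable_hiddenLaw hν hv
  have hsq : ∫ x : Space d, ⟪x, v⟫ ^ 2 ∂(hiddenLaw ν v) = ∫ x, x ^ 2 ∂ν := by
    conv_rhs => rw [← map_inner_hiddenLaw ν hv]
    rw [integral_map (by fun_prop) (by fun_prop)]
  have hquad : ∑ a, ∑ b, v a * v b * covMatrix (hiddenLaw ν v) a b = ∫ x, x ^ 2 ∂ν := by
    have e : ∀ x : Space d, ⟪x, v⟫ ^ 2 = ∑ a, ∑ b, v a * v b * (x a * x b) := by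
      intro x
      rw [PiLp.inner_apply, pow_two, Finset.sum_mul_sum]
      refine Finset.sum_congr rfl fun a _ => Finset.sum_congr rfl fun b _ => ?_
      simp
      ring
    rw [← hsq]
    simp only [e]
    rw [integral_finsetSum _ fun a _ => integrable_finsetSum _ fun b _ => (hint a b).const_mul _]
    refine Finset.sum_congr rfl fun a _ => ?_
    rw [integral_finsetSum _ fun b _ => (hint a b).const_mul _]
    refine Finset.sum_congr rfl fun b _ => ?_
    rw [integral_const_mul, hcov]
  set T := Matrix.toEuclideanCLM (n := Fin d) (𝕜 := ℝ) (covMatrix (hiddenLaw ν v) - 1) with hT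
  have hTv : ⟪v, T v⟫ = ∫ x, x ^ 2 ∂ν - 1 := by
    have hv2 : ⟪v, v⟫ = (1 : ℝ) := by rw [real_inner_self_eq_norm_sq, hv]; norm_num
    rw [hT, map_sub, map_one, sub_apply, inner_sub_right,
      one_apply_eq_self, hv2, ← hquad]
    congr 1
    rw [PiLp.inner_apply]
    refine Finset.sum_congr rfl fun a _ => ?_
    simp [Matrix.mulVec, dotProduct, Finset.sum_mul]
    refine Finset.sum_congr rfl fun b _ => ?_
    ring
  rw [← hTv]
  calc |⟪v, T v⟫| ≤ ‖v‖ * ‖T v‖ := abs_real_inner_le_norm _ _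
    _ ≤ ‖v‖ * (‖T‖ * ‖v‖) := by gcongr; exact T.le_opNorm v
    _ = ‖T‖ := by rw [hv]; ring

/-! ### Summing the Hermite coefficients -/

theorem sum_range_le_of_geometric {b : ℕ → ℝ} {N D : ℕ} {M x : ℝ} (hM : 0 ≤ M)
    (hx0 : 0 ≤ x) (hx : x ≤ 1 / 2) (h0 : b 0 ≤ 1) (hz : ∀ k, 1 ≤ k → k < N → b k = 0)
    (hb : ∀ k, N ≤ k → k ≤ D → b k ≤ M * x ^ k) :
    ∑ k ∈ Finset.range (D + 1), b k ≤ 1 + 2 * M * x ^ N := by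
  have h1 : ∀ k ∈ Finset.range (D + 1),
      b k ≤ (if k = 0 then 1 else 0) + if N ≤ k then M * x ^ k else 0 := by
    intro k hk
    have hMx : 0 ≤ M * x ^ k := by positivity
    rcases Nat.eq_zero_or_pos k with rfl | hk0
    · rw [if_pos rfl]
      rw [pow_zero, mul_one] at hMx ⊢
      split_ifs <;> linarith
    · rw [if_neg hk0.ne', zero_add]
      split_ifs with hN
      · exact hb k hN (Nat.lt_succ_iff.1 (Finset.mem_range.1 hk))
      · exact (hz k hk0 (not_le.1 hN)).le
  refine (Finset.sum_le_sum h1).trans ?_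
  rw [Finset.sum_add_distrib]
  have h2 : ∑ k ∈ Finset.range (D + 1), (if k = 0 then (1 : ℝ) else 0) = 1 := by simp
  have h3 : ∑ k ∈ Finset.range (D + 1), (if N ≤ k then M * x ^ k else 0)
      ≤ ∑ k ∈ Finset.range (N + (D + 1)), (if N ≤ k then M * x ^ k else 0) := by
    refine Finset.sum_le_sum_of_subset_of_nonneg (Finset.range_mono (by omega)) fun k _ _ => ?_
    split_ifs
    · positivity
    · exact le_rfl
  have h4 : ∑ k ∈ Finset.range N, (if N ≤ k then M * x ^ k else 0) = 0 :=
    Finset.sum_eq_zero fun k hk => if_neg (not_le.2 (Finset.mem_range.1 hk))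
  have h5 : ∑ k ∈ Finset.range (D + 1), x ^ k ≤ 2 := by
    have := mul_neg_geom_sum x (D + 1)
    have h6 : 0 ≤ x ^ (D + 1) := by positivity
    have h7 : 0 ≤ ∑ k ∈ Finset.range (D + 1), x ^ k := Finset.sum_nonneg fun _ _ => by positivity
    nlinarith
  rw [Finset.sum_range_add _ N (D + 1), h4, zero_add] at h3
  have h6 : ∑ k ∈ Finset.range (D + 1), (if N ≤ N + k then M * x ^ (N + k) else 0)
      = M * x ^ N * ∑ k ∈ Finset.range (D + 1), x ^ k := by
    rw [Finset.mul_sum]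
    refine Finset.sum_congr rfl fun k _ => ?_
    rw [if_pos (by omega), pow_add, mul_assoc]
  rw [h6] at h3
  have h8 : M * x ^ N * ∑ k ∈ Finset.range (D + 1), x ^ k ≤ M * x ^ N * 2 := by gcongr
  linarith

/-- The scalar estimate behind the bound on the advantage, with `i = 2 j`. -/
theorem sum_hermite_pow_le_four {j d n D : ℕ} {η α K : ℝ} {a : ℕ → ℝ} (hK : 1 ≤ K) (hd : 0 < d)
    (hη : 0 < η) (hηd : 1 ≤ η ^ 2 * d) (hα : η ≤ α) (ha0 : a 0 = 1)
    (haz : ∀ k, 1 ≤ k → k < 2 * j + 2 → a k = 0)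
    (hab : ∀ k, 2 * j + 2 ≤ k →
      a k ^ 2 ≤ (K + 1) ^ 2 * η ^ 2 * (k.factorial * (1 + α / η) ^ k))
    (hdn : (d : ℝ) ≤ n)
    (hn : (n : ℝ) ≤ (d : ℝ) ^ (j + 1) * η ^ (2 * j)
      / (2 * (K + 1) ^ 2 * 16 ^ (j + 1) * ((D : ℝ) + 1) ^ (3 * (j + 1)) * α ^ (2 * j + 2))) :
    (∑ k ∈ Finset.range (D + 1), a k ^ 2 * √(D / d : ℝ) ^ k) ^ n ≤ 4 := by
  have hd0 : (0 : ℝ) < d := by exact_mod_cast hd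
  have hα0 : 0 < α := hη.trans_le hα
  have hD0 : (0 : ℝ) ≤ D := by positivity
  -- up to a constant and a power of `D`, the number `r` is the square of the ratio of the series
  set r : ℝ := α ^ 2 / (η ^ 2 * d) with hr
  have hr0 : 0 < r := by positivity
  set P : ℝ := 2 * (K + 1) ^ 2 * 16 ^ (j + 1) * ((D : ℝ) + 1) ^ (3 * (j + 1)) with hP
  have hP0 : 0 < P := by positivity
  have hnP : n * η ^ 2 * (P * r ^ (j + 1)) ≤ 1 := by
    rw [le_div_iff₀ (by positivity)] at hn
    have e : r ^ (j + 1) = α ^ (2 * j + 2) / (η ^ (2 * j) * η ^ 2 * (d : ℝ) ^ (j + 1)) := by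
      rw [hr, div_pow, mul_pow, ← pow_mul, ← pow_mul]
      ring_nf
    rw [e]
    have : n * η ^ 2 * (P * (α ^ (2 * j + 2) / (η ^ (2 * j) * η ^ 2 * (d : ℝ) ^ (j + 1))))
        = n * (P * α ^ (2 * j + 2)) / ((d : ℝ) ^ (j + 1) * η ^ (2 * j)) := by
      field_simp
    rw [this, div_le_one (by positivity)]
    exact hn
  -- the lower bound on `n` enters only here, and bounds the ratio of the geometric series
  have hPr : P * r ^ (j + 1) ≤ 1 := by
    have h1 : 1 ≤ n * η ^ 2 := by
      calc 1 ≤ η ^ 2 * d := hηd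
        _ ≤ η ^ 2 * n := by gcongr
        _ = _ := mul_comm _ _
    have h2 : 0 ≤ P * r ^ (j + 1) := by positivity
    nlinarith
  set T : ℝ := 1 + α / η with hT
  have hT0 : 0 ≤ T := by positivity
  have hT2 : T ≤ 2 * (α / η) := by
    have : 1 ≤ α / η := by rwa [one_le_div hη]
    linarith
  set x : ℝ := D * T * √(D / d : ℝ) with hx
  have hx0 : 0 ≤ x := by positivity
  have hx2 : x ^ 2 ≤ 4 * (((D : ℝ) + 1) ^ 3 * r) := by
    have e1 : x ^ 2 = (D : ℝ) ^ 3 * T ^ 2 / d := by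
      rw [hx, mul_pow, mul_pow, Real.sq_sqrt (by positivity)]
      ring
    have e2 : T ^ 2 ≤ 4 * (α / η) ^ 2 := by
      calc T ^ 2 ≤ (2 * (α / η)) ^ 2 := by gcongr
        _ = _ := by ring
    rw [e1]
    calc (D : ℝ) ^ 3 * T ^ 2 / d ≤ ((D : ℝ) + 1) ^ 3 * (4 * (α / η) ^ 2) / d := by
          gcongr
          linarith
      _ = _ := by rw [hr]; field_simp
  have hxj : x ^ (2 * j + 2) ≤ 4 ^ (j + 1) * (((D : ℝ) + 1) ^ (3 * (j + 1)) * r ^ (j + 1)) := by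
    calc x ^ (2 * j + 2) = (x ^ 2) ^ (j + 1) := by rw [← pow_mul]; ring_nf
      _ ≤ (4 * (((D : ℝ) + 1) ^ 3 * r)) ^ (j + 1) := by gcongr
      _ = _ := by rw [mul_pow, mul_pow, ← pow_mul]
  have hK2 : 1 ≤ 2 * (K + 1) ^ 2 := by nlinarith
  have hxhalf : x ≤ 1 / 2 := by
    have h1 : (x ^ 2) ^ (j + 1) ≤ (1 / 4) ^ (j + 1) := by
      have h2 : (16 : ℝ) ^ (j + 1) * (((D : ℝ) + 1) ^ (3 * (j + 1)) * r ^ (j + 1)) ≤ 1 := by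
        refine le_trans ?_ hPr
        rw [hP]
        have h3 : 0 ≤ (16 : ℝ) ^ (j + 1) * (((D : ℝ) + 1) ^ (3 * (j + 1)) * r ^ (j + 1)) := by
          positivity
        nlinarith
      calc (x ^ 2) ^ (j + 1) = x ^ (2 * j + 2) := by rw [← pow_mul]; ring_nf
        _ ≤ 4 ^ (j + 1) * (((D : ℝ) + 1) ^ (3 * (j + 1)) * r ^ (j + 1)) := hxj
        _ = (1 / 4) ^ (j + 1) * (16 ^ (j + 1) * (((D : ℝ) + 1) ^ (3 * (j + 1)) * r ^ (j + 1))) := by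
            have h4 : (1 / 4 : ℝ) ^ (j + 1) * 16 ^ (j + 1) = 4 ^ (j + 1) := by
              rw [← mul_pow]
              norm_num
            rw [← h4]
            ring
        _ ≤ (1 / 4) ^ (j + 1) := mul_le_of_le_one_right (by positivity) h2
    have h2 : x ^ 2 ≤ 1 / 4 := (pow_le_pow_iff_left₀ (sq_nonneg x) (by norm_num) (by omega)).1 h1
    nlinarith
  have hsum : ∑ k ∈ Finset.range (D + 1), a k ^ 2 * √(D / d : ℝ) ^ k
      ≤ 1 + 2 * ((K + 1) ^ 2 * η ^ 2) * x ^ (2 * j + 2) := by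
    refine sum_range_le_of_geometric (by positivity) hx0 hxhalf (by simp [ha0])
      (fun k h1 h2 => by rw [haz k h1 h2]; ring) fun k h1 h2 => ?_
    have hfac : (k.factorial : ℝ) ≤ (D : ℝ) ^ k := by
      have h3 : k.factorial ≤ D ^ k :=
        (Nat.factorial_le_pow k).trans (Nat.pow_le_pow_left h2 k)
      exact_mod_cast h3
    calc a k ^ 2 * √(D / d : ℝ) ^ k
        ≤ (K + 1) ^ 2 * η ^ 2 * (k.factorial * T ^ k) * √(D / d : ℝ) ^ k := by
          gcongr
          exact hab k h1
      _ ≤ (K + 1) ^ 2 * η ^ 2 * ((D : ℝ) ^ k * T ^ k) * √(D / d : ℝ) ^ k := by gcongr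
      _ = _ := by rw [hx, mul_pow, mul_pow]; ring
  set y : ℝ := 2 * ((K + 1) ^ 2 * η ^ 2) * x ^ (2 * j + 2)
  have hny : n * y ≤ 1 := by
    refine le_trans ?_ hnP
    calc n * y ≤ n * (2 * ((K + 1) ^ 2 * η ^ 2) *
          (16 ^ (j + 1) * (((D : ℝ) + 1) ^ (3 * (j + 1)) * r ^ (j + 1)))) := by
          refine mul_le_mul_of_nonneg_left (mul_le_mul_of_nonneg_left (hxj.trans ?_)
            (by positivity)) (by positivity)
          gcongr
          norm_num
      _ = _ := by rw [hP]; ring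
  have hs0 : 0 ≤ ∑ k ∈ Finset.range (D + 1), a k ^ 2 * √(D / d : ℝ) ^ k :=
    Finset.sum_nonneg fun _ _ => by positivity
  calc (∑ k ∈ Finset.range (D + 1), a k ^ 2 * √(D / d : ℝ) ^ k) ^ n ≤ (1 + y) ^ n := by gcongr
    _ ≤ Real.exp y ^ n := by
        have : 0 ≤ y := by positivity
        gcongr
        linarith [Real.add_one_le_exp y]
    _ = Real.exp (n * y) := by rw [← Real.exp_nat_mul]
    _ ≤ Real.exp 1 := Real.exp_le_exp.2 hny
    _ ≤ 4 := by linarith [Real.exp_one_lt_d9]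

/-- The upper bound on `α` keeps the `2 j`-th moment of the outliers, weighted by `η`, small. -/
theorem mul_pow_le_of_rpow_le {j : ℕ} (hj : 0 < j) {η α K : ℝ} (hη : 0 < η) (hα : η ≤ α)
    (hK : 1 ≤ K) (h : α ≤ 1 / (4 * K) * η ^ (1 - 2 / ((2 * j : ℕ) : ℝ))) :
    K * (η * (1 + α / η) ^ j) ≤ 1 / 2 := by
  have hj0 : (0 : ℝ) < j := by exact_mod_cast hj
  have hα0 : 0 < α := hη.trans_le hα
  have h1 : η * (η ^ (1 - 2 / ((2 * j : ℕ) : ℝ))) ^ j = η ^ j := by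
    rw [← Real.rpow_natCast (η ^ _), ← Real.rpow_mul hη.le]
    have : (1 - 2 / ((2 * j : ℕ) : ℝ)) * (j : ℝ) = j - 1 := by
      push_cast
      field_simp
    rw [this, Real.rpow_sub hη, Real.rpow_natCast, Real.rpow_one]
    field_simp
  have h2 : 1 + α / η ≤ 2 * (α / η) := by
    have : 1 ≤ α / η := by rwa [one_le_div hη]
    linarith
  have h3 : (1 / (2 * K)) ^ j ≤ 1 / (2 * K) := by
    refine pow_le_of_le_one (by positivity) ?_ hj.ne'
    rw [div_le_one (by positivity)]
    linarith
  calc K * (η * (1 + α / η) ^ j) ≤ K * (η * (2 * (α / η)) ^ j) := by gcongr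
    _ ≤ K * (η * (2 * ((1 / (4 * K) * η ^ (1 - 2 / ((2 * j : ℕ) : ℝ))) / η)) ^ j) := by gcongr
    _ = K * ((1 / (2 * K)) ^ j * (η * (η ^ (1 - 2 / ((2 * j : ℕ) : ℝ))) ^ j / η ^ j)) := by
        rw [show (2 * ((1 / (4 * K) * η ^ (1 - 2 / ((2 * j : ℕ) : ℝ))) / η))
          = (1 / (2 * K)) * (η ^ (1 - 2 / ((2 * j : ℕ) : ℝ)) / η) by field_simp; ring,
          mul_pow, div_pow]
        ring
    _ = K * (1 / (2 * K)) ^ j := by rw [h1, div_self (by positivity), mul_one]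
    _ ≤ K * (1 / (2 * K)) := by gcongr
    _ = 1 / 2 := by field_simp

end LowDegree

theorem proposition8p16 (i : ℕ) (hi : Even i) (hi0 : 0 < i) :
    -- the constants depend on `i` only
    ∃ (c c' C s B : ℝ) (p : Polynomial ℝ),
      0 < c ∧ 0 < c' ∧ 0 < C ∧ 0 < s ∧ (∀ D : ℕ, 0 < p.eval (D : ℝ)) ∧
      ∀ (d : ℕ) (η α : ℝ), 0 < d →
        C / √(d : ℝ) ≤ η → η ≤ 1 / 10 ^ 5 →
        -- the range of `α` in the testing problem
        η * Real.log (1 / η) < α → α < 1 / 10 →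
        c' * η ^ (1 - 2 / ((i : ℝ) + 2)) ≤ α → α ≤ c * η ^ (1 - 2 / (i : ℝ)) →
        ∃ (Dv Qv : ProbabilityTheory.Kernel (LowDegree.UnitSphere d) (LowDegree.Space d)),
          ProbabilityTheory.IsMarkovKernel Dv ∧ ProbabilityTheory.IsMarkovKernel Qv ∧
          (∀ v, LowDegree.IsInlier s α (Dv v)) ∧
          ∀ n D : ℕ, C * (d : ℝ) ≤ n →
            (n : ℝ) ≤ (d : ℝ) ^ (((i : ℝ) + 2) / 2) * η ^ i / (p.eval (D : ℝ) * α ^ (i + 2)) →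
            -- every expectation in the advantage exists
            (∀ f : MvPolynomial (Fin n × Fin d) ℝ, f.totalDegree ≤ D →
              MeasureTheory.Integrable (LowDegree.evalSample f)
                (LowDegree.altLaw d n η Dv Qv)) ∧
            LowDegree.advantage D (LowDegree.altLaw d n η Dv Qv) (LowDegree.nullLaw d n)
              ≤ (B : EReal) := by
  obtain ⟨K, hK, hmatch⟩ := LowDegree.exists_moment_matching hi hi0
  -- `i = 2 j`
  obtain ⟨j, rfl⟩ := hi.exists_two_nsmul
  rw [smul_eq_mul] at *
  have hj : 0 < j := by omega
  refine ⟨1 / (4 * K), 1, 1, 4, 2,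
    Polynomial.C (2 * (K + 1) ^ 2 * 16 ^ (j + 1)) * (Polynomial.X + 1) ^ (3 * (j + 1)),
    by positivity, one_pos, one_pos, by norm_num, fun D => ?_, ?_⟩
  · simp only [Polynomial.eval_mul, Polynomial.eval_C, Polynomial.eval_pow, Polynomial.eval_add,
      Polynomial.eval_X, Polynomial.eval_one]
    positivity
  intro d η α hd hηd hη5 hαlog _ _ hαup
  have hd0 : (0 : ℝ) < d := by exact_mod_cast hd
  have hη : 0 < η := lt_of_lt_of_le (by positivity) hηd
  have hα : η ≤ α := by
    have h1 : 1 ≤ Real.log (1 / η) := by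
      rw [Real.le_log_iff_exp_le (by positivity)]
      have h2 : (10 : ℝ) ^ 5 ≤ 1 / η := by
        rw [le_div_iff₀ hη]
        linarith
      linarith [Real.exp_one_lt_d9]
    nlinarith
  have hηd2 : 1 ≤ η ^ 2 * d := by
    rw [div_le_iff₀ (by positivity)] at hηd
    calc (1 : ℝ) ≤ (η * √(d : ℝ)) ^ 2 := one_le_pow₀ hηd
      _ = _ := by rw [mul_pow, Real.sq_sqrt hd0.le]
  have hα0 : 0 < α := hη.trans_le hα
  -- the outliers sit at `± t`, so that the variance along `v` is `1 - α / (1 - η)`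
  set t : ℝ := √(1 + α / η)
  have ht2 : t ^ 2 = 1 + α / η := Real.sq_sqrt (by positivity)
  have ht : 1 ≤ t := by
    have : 0 ≤ α / η := by positivity
    exact Real.one_le_sqrt.2 (by linarith)
  have hη2 : η ≤ 1 / 2 := hη5.trans (by norm_num)
  obtain ⟨ν₁, ν₂, hp₁, hp₂, hν₂, hle, hmean, hvar, haz, hab⟩ := hmatch η t hη hη2 ht (by
    rw [pow_mul, ht2]
    exact LowDegree.mul_pow_le_of_rpow_le hj hη hα hK hαup)
  have hν₁ := LowDegree.hasMoments_of_le hle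
  refine ⟨LowDegree.hiddenKernel d ν₁, LowDegree.hiddenKernel d ν₂, inferInstance, inferInstance,
    fun v => ?_, ?_⟩
  · have hv : ‖(v : LowDegree.Space d)‖ = 1 := by simp
    refine ⟨LowDegree.isProbabilityMeasure_hiddenLaw ν₁ (v : LowDegree.Space d),
      LowDegree.integral_id_hiddenLaw hν₁ hmean hv,
      LowDegree.isSubgaussian_hiddenLaw hle hmean hv, ?_⟩
    refine le_trans ?_ (LowDegree.le_norm_covMatrix_hiddenLaw hν₁ hmean hv)
    rw [hvar, ht2]
    have e : 1 - η / (1 - η) * (1 + α / η - 1) - 1 = -(α / (1 - η)) := by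
      have : 1 - η ≠ 0 := by linarith
      field_simp
      ring
    rw [e, abs_neg]
    refine le_trans ?_ (le_abs_self _)
    rw [le_div_iff₀ (by linarith)]
    nlinarith
  · intro n D hdn hn
    obtain ⟨hint, hadv⟩ := LowDegree.advantage_hiddenKernel_le (n := n) (D := D) hd hη.le
      (hη2.trans (by norm_num)) hν₁ hν₂
    refine ⟨hint, hadv.trans ?_⟩
    rw [EReal.coe_le_coe_iff, Real.sqrt_le_left (by norm_num)]
    have := LowDegree.isProbabilityMeasure_lineMixture hη.le (hη2.trans (by norm_num)) ν₁ ν₂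
    norm_num only
    refine LowDegree.sum_hermite_pow_le_four hK hd hη hηd2 hα (by simp) haz
      (fun k hk => by rw [← ht2]; exact hab k hk) (by simpa using hdn) ?_
    have e1 : (((2 * j : ℕ) : ℝ) + 2) / 2 = ((j + 1 : ℕ) : ℝ) := by
      push_cast
      ring
    rw [e1, Real.rpow_natCast] at hn
    simpa using hn
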